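/- Fix sorted (integer and array) program variables $X$ with primed copies $X'$ and integer Skolem constants $SK=\{sk_0,sk_1,\dots\}$, and work in first-order logic over linear integer arithmetic and arrays (standard integers, arrays as maps $\mathbb Z\to\mathbb Z$). Let $P=\langle \mathit{Init}(X),\mathit{Tr}(X,X'),\mathit{Bad}(X)\rangle$ be a safety problem whose three formulas are quantifier free and ground, with $\mathit{Bad}$ a monomial (conjunction of literals). **Procedures used.** - A satisfiability solver whose answers are correct ("sat" with a model, or "unsat") and which is guaranteed to answer on quantifier-free formulas; on formulas with quantifiers it may run forever. - A partial model based projection: for ground $\varphi$ and $M\models\varphi$, $\mathrm{pMbp}(U,\varphi,M)=(\psi,W)$ with $\psi$ a ground monomial, $W\subseteq U$, $\mathit{Const}(\psi)\subseteq \mathit{Const}(\varphi)\setminus(U\setminus W)$, $\psi\Rightarrow\exists (U\setminus W)\cdot\varphi$, $M\models\psi$, and for fixed $U,\varphi$ only finitely many results as $M$ ranges over the models of $\varphi$. In all projections that arise from $P$ (starting with $\mathit{Bad}$ and taking predecessors, as below), $W$ contains no array constants. - A partial interpolation: for ground $A$ and a ground monomial $B$ with $A\Rightarrow\neg B$, $\mathrm{pItp}(A,B)=(\varphi,U)$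 with $\varphi$ a ground clause, $U\subseteq \mathit{Const}(B)\setminus \mathit{Const}(A)$, $\mathit{Const}(\varphi)\subseteq(\mathit{Const}(A)\cap \mathit{Const}(B))\cup U$, $A\Rightarrow\forall U\cdot\varphi$ and $\varphi\Rightarrow\neg B$. - An abstraction function: for ground $\varphi$ in which the constants of $U$ that occur are integers, $\mathrm{abs}(U,\varphi)=(\psi,\sigma)$ where $\psi$ is $\varphi$ with the constants of $U$ replaced by pairwise distinct variables, $sk_i$ being replaced by variable $i$, and $\sigma$ maps these variables back. **Quic3_Main.** A proof obligation (POB) is a triple $\langle m,\sigma,i\rangle$; a frame $Q_i$ is a finite set of pairs $(\ell,\sigma)$ of a lemma and a substitution; $\mathit{qi}(Q)$ is the conjunction of all $\ell\sigma$, $(\ell,\sigma)\in Q$, and $\forall Q$ is the set of universal closures of its lemmas. Write $m'_{sk}$ for $m$ with program variables primed and each variable $i$ replaced by $sk_i$. Initially $N=0$, $Q_0=\{(\mathit{Init},\emptyset)\}$, and all other frames are empty. If $\mathit{Init}\wedge\mathit{Bad}$ is satisfiable, return Cex. Otherwise repeat: set $N\gets N+1$, $Q_N\gets\emptyset$, and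 perform the following two phases. *MakeSafe.* Start with the queue $\{\langle \mathit{Bad},\emptyset,N\rangle\}$. While it is non-empty, take a POB $\langle m,\xi,i\rangle$ of lowest level. If $i=0$, return Cex. Query the solver on $\mathit{qi}(Q_{i-1})\wedge\mathit{Tr}\wedge m'_{sk}$. If it returns a model $M$, add $\langle\psi,\sigma,i-1\rangle$ to the queue, where $(\varphi,U)=\mathrm{pMbp}(X'\cup SK,\mathit{Tr}\wedge m'_{sk},M)$ and $(\psi,\sigma)=\mathrm{abs}(U,\varphi)$. If it answers unsat, remove the POB, let $L'$ be the clause of $\mathrm{pItp}(\mathit{qi}(Q_{i-1})\wedge\mathit{Tr},m'_{sk})$ and $\ell$ the formula of $\mathrm{abs}(SK,L)$. Optionally replace $(\ell,\xi)$ by a generalization $(g,\sigma)$ from a finite list of candidates, with $g$ quantifier free, $g\sigma$ ground, $g\sigma\equiv\ell\xi$, $\mathit{FVars}(\ell)\subseteq\mathit{FVars}(g)$, and such that the solver finds $((\mathit{qi}(Q_{i-1})\wedge\mathit{Tr})\vee\mathit{Init}')\wedge\neg g'$ unsatisfiable. Add the resulting pair to all $Q_j$, $j\le i$. *Push.* For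 $i=0,\dots,N-1$, go through some finite list of pairs $(\varphi,\sigma)$; when some $(\varphi\vee\psi,\sigma)\in Q_i$ ($\psi$ possibly empty), $(\varphi,\sigma)\notin Q_{i+1}$, and the solver finds unsatisfiable both $\mathit{Init}\wedge\neg\varphi$ and the conjunction of $\mathit{qi}(Q_i)$, $\mathit{Tr}$, $\neg\varphi'$ and finitely many chosen instances of $\varphi$ and of the lemmas of $Q_i$, add $(\varphi,\sigma)$ to all $Q_j$, $j\le i+1$. Afterwards, if $\forall Q_i\subseteq\forall Q_{i+1}$ for some $i<N$, return Safe. **Lemma (progress).** For every such $P$, all procedures as above, every maximal run of Quic3_Main (whatever the models returned by the solver and the heuristic choices) and every $k\in\mathbb N$: after finitely many steps the run reaches $N=k$, or returns Safe, or finds a counterexample (it returns Cex, and $P$ has a counterexample, of length the current $N$). -/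

import Mathlib

namespace Quic3

universe u

/-! ## The logic: linear integer arithmetic and arrays -/

/-- The two sorts. Array indices and array data are integers. -/
inductive Srt : Type
  | int
  | arr

/-- Uninterpreted constants over a sorted family `X` of program variables: the program variables
(pre-state), their primed copies (post-state), and the integer Skolem constants `sk 0, sk 1, …`. -/
inductive Const (X : Srt → Type u) : Srt → Type u
  | cur {s : Srt} (x : X s) : Const X s
  | nxt {s : Srt} (x : X s) : Const X s
  | sk (i : ℕ) : Const X Srt.int

/-- A constant together with its sort. -/
abbrev AnyConst (X : Srt → Type u) : Type u := Σ s, Const X s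

/-- Terms. Variables are integer variables, named by natural numbers; multiplication is linear,
i.e. by a numeral. -/
inductive Term (X : Srt → Type u) : Srt → Type u
  | var (i : ℕ) : Term X Srt.int
  | con {s : Srt} (c : Const X s) : Term X s
  | num (n : ℤ) : Term X Srt.int
  | add (a b : Term X Srt.int) : Term X Srt.int
  | sub (a b : Term X Srt.int) : Term X Srt.int
  | mul (n : ℤ) (a : Term X Srt.int) : Term X Srt.int
  | sel (a : Term X Srt.arr) (i : Term X Srt.int) : Term X Srt.int
  | store (a : Term X Srt.arr) (i v : Term X Srt.int) : Term X Srt.arr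

/-- First-order formulas; quantification is over integer variables. -/
inductive Formula (X : Srt → Type u) : Type u
  | tru : Formula X
  | fls : Formula X
  | lt (a b : Term X Srt.int) : Formula X
  | le (a b : Term X Srt.int) : Formula X
  | eq {s : Srt} (a b : Term X s) : Formula X
  | not (φ : Formula X) : Formula X
  | and (φ ψ : Formula X) : Formula X
  | or (φ ψ : Formula X) : Formula X
  | all (i : ℕ) (φ : Formula X) : Formula X

/-- Values: integers, and arrays as total maps from integers to integers. -/
abbrev Val : Srt → Type
  | Srt.int => ℤ
  | Srt.arr => ℤ → ℤ

/-- A structure: an interpretation of all uninterpreted constants. The interpreted symbols have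
their standard meaning. -/
abbrev Struct (X : Srt → Type u) : Type u := ∀ s, Const X s → Val s

/-- Values of the free variables. -/
abbrev Env : Type := ℕ → ℤ

/-- The value of a term. -/
def Term.eval {X : Srt → Type u} (M : Struct X) (e : Env) : {s : Srt} → Term X s → Val s
  | _, .var i => e i
  | _, .con c => M _ c
  | _, .num n => n
  | _, .add a b => (a.eval M e + b.eval M e : ℤ)
  | _, .sub a b => (a.eval M e - b.eval M e : ℤ)
  | _, .mul n a => (n * a.eval M e : ℤ)
  | _, .sel a i => (a.eval M e : ℤ → ℤ) (i.eval M e)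
  | _, .store a i v => Function.update (a.eval M e : ℤ → ℤ) (i.eval M e) (v.eval M e)

/-- Truth of a formula in a structure, under an assignment of the free variables. -/
def Formula.Sat {X : Srt → Type u} (M : Struct X) : Env → Formula X → Prop
  | _, .tru => True
  | _, .fls => False
  | e, .lt a b => (a.eval M e : ℤ) < b.eval M e
  | e, .le a b => (a.eval M e : ℤ) ≤ b.eval M e
  | e, .eq a b => a.eval M e = b.eval M e
  | e, .not φ => ¬ φ.Sat M e
  | e, .and φ ψ => φ.Sat M e ∧ ψ.Sat M e
  | e, .or φ ψ => φ.Sat M e ∨ ψ.Sat M e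
  | e, .all i φ => ∀ n : ℤ, φ.Sat M (Function.update e i n)

/-- `M ⊨ φ` (under every assignment; the assignment is irrelevant when `φ` is ground). -/
def Models {X : Srt → Type u} (M : Struct X) (φ : Formula X) : Prop := ∀ e, φ.Sat M e

/-- Satisfiability. Free variables are read existentially. -/
def Satisfiable {X : Srt → Type u} (φ : Formula X) : Prop := ∃ M e, φ.Sat M e

/-- `φ ⇒ ψ`: validity of the implication. -/
def Entails {X : Srt → Type u} (φ ψ : Formula X) : Prop := ∀ M e, φ.Sat M e → ψ.Sat M e

/-- `φ ≡ ψ`. -/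
def Equivalent {X : Srt → Type u} (φ ψ : Formula X) : Prop := ∀ M e, φ.Sat M e ↔ ψ.Sat M e

/-- `M` and `M'` may differ only on the constants in `U`. -/
def AgreeOff {X : Srt → Type u} (U : Set (AnyConst X)) (M M' : Struct X) : Prop :=
  ∀ s (c : Const X s), (⟨s, c⟩ : AnyConst X) ∉ U → M s c = M' s c

def Term.fvars {X : Srt → Type u} : {s : Srt} → Term X s → Finset ℕ
  | _, .var i => {i}
  | _, .con _ => ∅
  | _, .num _ => ∅
  | _, .add a b => a.fvars ∪ b.fvars
  | _, .sub a b => a.fvars ∪ b.fvars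
  | _, .mul _ a => a.fvars
  | _, .sel a i => a.fvars ∪ i.fvars
  | _, .store a i v => a.fvars ∪ (i.fvars ∪ v.fvars)

def Formula.fvars {X : Srt → Type u} : Formula X → Finset ℕ
  | .tru => ∅
  | .fls => ∅
  | .lt a b => a.fvars ∪ b.fvars
  | .le a b => a.fvars ∪ b.fvars
  | .eq a b => a.fvars ∪ b.fvars
  | .not φ => φ.fvars
  | .and φ ψ => φ.fvars ∪ ψ.fvars
  | .or φ ψ => φ.fvars ∪ ψ.fvars
  | .all i φ => φ.fvars.erase i

/-- The uninterpreted constants of a term. -/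
def Term.consts {X : Srt → Type u} : {s : Srt} → Term X s → Set (AnyConst X)
  | _, .var _ => ∅
  | s, .con c => {⟨s, c⟩}
  | _, .num _ => ∅
  | _, .add a b => a.consts ∪ b.consts
  | _, .sub a b => a.consts ∪ b.consts
  | _, .mul _ a => a.consts
  | _, .sel a i => a.consts ∪ i.consts
  | _, .store a i v => a.consts ∪ (i.consts ∪ v.consts)

/-- The uninterpreted constants of a formula. -/
def Formula.consts {X : Srt → Type u} : Formula X → Set (AnyConst X)
  | .tru => ∅
  | .fls => ∅
  | .lt a b => a.consts ∪ b.consts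
  | .le a b => a.consts ∪ b.consts
  | .eq a b => a.consts ∪ b.consts
  | .not φ => φ.consts
  | .and φ ψ => φ.consts ∪ ψ.consts
  | .or φ ψ => φ.consts ∪ ψ.consts
  | .all _ φ => φ.consts

/-- Quantifier-free formulas. -/
def Formula.QF {X : Srt → Type u} : Formula X → Prop
  | .not φ => φ.QF
  | .and φ ψ => φ.QF ∧ ψ.QF
  | .or φ ψ => φ.QF ∧ ψ.QF
  | .all _ _ => False
  | _ => True

/-- Ground formulas: quantifier free, without variables. -/
def Formula.Ground {X : Srt → Type u} (φ : Formula X) : Prop := φ.QF ∧ φ.fvars = ∅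

def Formula.IsAtom {X : Srt → Type u} : Formula X → Prop
  | .tru => True
  | .fls => True
  | .lt _ _ => True
  | .le _ _ => True
  | .eq _ _ => True
  | _ => False

def Formula.IsLit {X : Srt → Type u} : Formula X → Prop
  | .not φ => φ.IsAtom
  | φ => φ.IsAtom

/-- Conjunctions of literals (monomials, cubes). -/
def Formula.IsMonomial {X : Srt → Type u} : Formula X → Prop
  | .and φ ψ => φ.IsMonomial ∧ ψ.IsMonomial
  | φ => φ.IsLit

/-- Disjunctions of literals. -/
def Formula.IsClause {X : Srt → Type u} : Formula X → Prop
  | .or φ ψ => φ.IsClause ∧ ψ.IsClause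
  | φ => φ.IsLit

/-- The top-level disjuncts of a formula. -/
def Formula.disjuncts {X : Srt → Type u} : Formula X → List (Formula X)
  | .fls => []
  | .or φ ψ => φ.disjuncts ++ ψ.disjuncts
  | φ => [φ]

/-- `χ` is `φ ∨ ψ` for some possibly empty `ψ`, up to the order, the bracketing and the repetition
of disjuncts. -/
def Formula.SubDisj {X : Srt → Type u} (φ χ : Formula X) : Prop := φ.disjuncts ⊆ χ.disjuncts

/-- Finite conjunctions. -/
def Formula.conj {X : Srt → Type u} (l : List (Formula X)) : Formula X :=
  l.foldr Formula.and Formula.tru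

/-- `∀ φ`: the universal closure. -/
def Formula.closure {X : Srt → Type u} (φ : Formula X) : Formula X :=
  (φ.fvars.sort (· ≤ ·)).foldr Formula.all φ

/-- Substitutions: partial maps from (integer) variables to terms. -/
abbrev Subst (X : Srt → Type u) : Type u := ℕ → Option (Term X Srt.int)

def Subst.empty {X : Srt → Type u} : Subst X := fun _ => none

def Subst.dom {X : Srt → Type u} (σ : Subst X) : Set ℕ := {i | (σ i).isSome}

/-- All terms in the range are without variables. -/
def Subst.IsGround {X : Srt → Type u} (σ : Subst X) : Prop := ∀ i t, σ i = some t → t.fvars = ∅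

def Term.subst {X : Srt → Type u} (σ : Subst X) : {s : Srt} → Term X s → Term X s
  | _, .var i => (σ i).getD (.var i)
  | _, .con c => .con c
  | _, .num n => .num n
  | _, .add a b => .add (a.subst σ) (b.subst σ)
  | _, .sub a b => .sub (a.subst σ) (b.subst σ)
  | _, .mul n a => .mul n (a.subst σ)
  | _, .sel a i => .sel (a.subst σ) (i.subst σ)
  | _, .store a i v => .store (a.subst σ) (i.subst σ) (v.subst σ)

/-- Applying a substitution. It is only ever applied to quantifier-free formulas, so that no
variable can be captured. -/
def Formula.subst {X : Srt → Type u} : Subst X → Formula X → Formula X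
  | _, .tru => .tru
  | _, .fls => .fls
  | σ, .lt a b => .lt (a.subst σ) (b.subst σ)
  | σ, .le a b => .le (a.subst σ) (b.subst σ)
  | σ, .eq a b => .eq (a.subst σ) (b.subst σ)
  | σ, .not φ => .not (φ.subst σ)
  | σ, .and φ ψ => .and (φ.subst σ) (ψ.subst σ)
  | σ, .or φ ψ => .or (φ.subst σ) (ψ.subst σ)
  | σ, .all i φ => .all i (φ.subst (Function.update σ i none))

/-- The Skolem substitution, mapping variable `i` to the Skolem constant `sk i`. -/
def skSubst {X : Srt → Type u} : Subst X := fun i => some (.con (.sk i))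

/-- `φ_sk`. -/
def Formula.skolem {X : Srt → Type u} (φ : Formula X) : Formula X := φ.subst skSubst

/-- Renaming of constants. -/
def Term.mapC {X : Srt → Type u} (f : ∀ s, Const X s → Const X s) : {s : Srt} → Term X s → Term X s
  | _, .var i => .var i
  | _, .con c => .con (f _ c)
  | _, .num n => .num n
  | _, .add a b => .add (a.mapC f) (b.mapC f)
  | _, .sub a b => .sub (a.mapC f) (b.mapC f)
  | _, .mul n a => .mul n (a.mapC f)
  | _, .sel a i => .sel (a.mapC f) (i.mapC f)
  | _, .store a i v => .store (a.mapC f) (i.mapC f) (v.mapC f)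

def Formula.mapC {X : Srt → Type u} (f : ∀ s, Const X s → Const X s) : Formula X → Formula X
  | .tru => .tru
  | .fls => .fls
  | .lt a b => .lt (a.mapC f) (b.mapC f)
  | .le a b => .le (a.mapC f) (b.mapC f)
  | .eq a b => .eq (a.mapC f) (b.mapC f)
  | .not φ => .not (φ.mapC f)
  | .and φ ψ => .and (φ.mapC f) (ψ.mapC f)
  | .or φ ψ => .or (φ.mapC f) (ψ.mapC f)
  | .all i φ => .all i (φ.mapC f)

def Const.prime {X : Srt → Type u} : ∀ s, Const X s → Const X s
  | _, .cur x => .nxt x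
  | _, .nxt x => .nxt x
  | _, .sk i => .sk i

def Const.unprime {X : Srt → Type u} : ∀ s, Const X s → Const X s
  | _, .cur x => .cur x
  | _, .nxt x => .cur x
  | _, .sk i => .sk i

/-- The primed formula: every program variable is replaced by its post-state copy. -/
def Formula.prime {X : Srt → Type u} (φ : Formula X) : Formula X := φ.mapC Const.prime

/-- For a formula without pre-state constants, the formula whose primed version it is. -/
def Formula.unprime {X : Srt → Type u} (φ : Formula X) : Formula X := φ.mapC Const.unprime

/-- The program variables. -/
def curSet (X : Srt → Type u) : Set (AnyConst X) := {c | ∃ s, ∃ x : X s, c = ⟨s, .cur x⟩}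

/-- The primed program variables. -/
def nxtSet (X : Srt → Type u) : Set (AnyConst X) := {c | ∃ s, ∃ x : X s, c = ⟨s, .nxt x⟩}

/-- The Skolem constants. -/
def skSet (X : Srt → Type u) : Set (AnyConst X) := {c | ∃ i : ℕ, c = ⟨Srt.int, .sk i⟩}

/-! ## Safety problems -/

structure SafetyProblem (X : Srt → Type u) where
  init : Formula X
  tr : Formula X
  bad : Formula X
  init_ground : init.Ground
  tr_ground : tr.Ground
  bad_ground : bad.Ground
  init_consts : init.consts ⊆ curSet X
  tr_consts : tr.consts ⊆ curSet X ∪ nxtSet X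
  bad_consts : bad.consts ⊆ curSet X

/-- States: interpretations of the program variables. -/
abbrev State (X : Srt → Type u) : Type u := ∀ s, X s → Val s

/-- The structure with pre-state `a` and post-state `b` (Skolem constants are irrelevant here). -/
def State.pair {X : Srt → Type u} (a b : State X) : Struct X
  | _, .cur x => a _ x
  | _, .nxt x => b _ x
  | _, .sk _ => (0 : ℤ)

/-- There is a counterexample of length `k`: an assignment to `k + 1` copies of the program
variables that satisfies `Init(X₀) ∧ Tr(X₀,X₁) ∧ … ∧ Tr(X_{k-1},X_k) ∧ Bad(X_k)`. -/
def SafetyProblem.HasCounterexample {X : Srt → Type u} (P : SafetyProblem X) (k : ℕ) : Prop :=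
  ∃ a : ℕ → State X,
    Models (State.pair (a 0) (a 0)) P.init ∧
    (∀ i < k, Models (State.pair (a i) (a (i + 1))) P.tr) ∧
    Models (State.pair (a k) (a k)) P.bad

/-! ## The procedures that the algorithm calls -/

/-- What may happen when the solver is called. -/
inductive Outcome (X : Srt → Type u) : Type u
  | sat (M : Struct X)
  | unsat
  | diverges

/-- A (not necessarily deterministic) satisfiability solver for first-order formulas. Its answers
are correct; it is guaranteed to answer on quantifier-free formulas, and may run forever on
formulas with quantifiers. -/
structure Solver (X : Srt → Type u) where
  /-- the possible outcomes of a call -/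
  call : Formula X → Outcome X → Prop
  exists_outcome : ∀ φ, ∃ o, call φ o
  sat_sound : ∀ φ M, call φ (.sat M) → ∃ e, φ.Sat M e
  unsat_sound : ∀ φ, call φ .unsat → ¬ Satisfiable φ
  terminates : ∀ φ, φ.QF → ¬ call φ .diverges

/-- An abstraction function: `abs U φ = (ψ, σ)` where `ψ` is `φ` with the constants in `U` replaced
by variables, and `σ` maps these variables back to the constants. Skolem constants `sk i` are
replaced by variable `i`. All variables being integers, only constants of sort `int` can be
replaced. -/
structure Abstraction (X : Srt → Type u) where
  abs : Set (AnyConst X) → Formula X → Formula X × Subst X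
  spec : ∀ (U : Set (AnyConst X)) (φ : Formula X), φ.Ground →
    (∀ c ∈ φ.consts ∩ U, c.1 = Srt.int) →
    (abs U φ).1.subst (abs U φ).2 = φ ∧
    (abs U φ).2.dom = {i | i ∈ (abs U φ).1.fvars ∧ i ∉ φ.fvars} ∧
    Disjoint U (abs U φ).1.consts ∧
    (∀ i t, (abs U φ).2 i = some t →
      ∃ c : Const X Srt.int, (⟨Srt.int, c⟩ : AnyConst X) ∈ U ∧ t = .con c) ∧
    (∀ i j t, (abs U φ).2 i = some t → (abs U φ).2 j = some t → i = j) ∧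
    (∀ i, (⟨Srt.int, .sk i⟩ : AnyConst X) ∈ U ∩ φ.consts →
      (abs U φ).2 i = some (.con (.sk i)))

/-- (Partial) model based projection: `mbp U φ M = (ψ, W)`, where `W` are the constants of `U` that
are not eliminated. -/
structure MBP (X : Srt → Type u) where
  mbp : Set (AnyConst X) → Formula X → Struct X → Formula X × Set (AnyConst X)
  ground_monomial : ∀ U φ M, φ.Ground → Models M φ →
    (mbp U φ M).1.IsMonomial ∧ (mbp U φ M).1.Ground
  consts_sub : ∀ U φ M, φ.Ground → Models M φ →
    (mbp U φ M).2 ⊆ U ∧ (mbp U φ M).1.consts ⊆ φ.consts \ (U \ (mbp U φ M).2)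
  /-- `ψ ⇒ ∃ U \ W · φ` -/
  under : ∀ U φ M, φ.Ground → Models M φ →
    ∀ M₁, Models M₁ (mbp U φ M).1 →
      ∃ M₂, AgreeOff (U \ (mbp U φ M).2) M₁ M₂ ∧ Models M₂ φ
  models : ∀ U φ M, φ.Ground → Models M φ → Models M (mbp U φ M).1
  finite_range : ∀ U φ, φ.Ground → {r | ∃ M, Models M φ ∧ r = mbp U φ M}.Finite

/-- (Partial) interpolation: `itp A B = (φ, U)`. -/
structure Interpolation (X : Srt → Type u) where
  itp : Formula X → Formula X → Formula X × Set (AnyConst X)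
  ground_clause : ∀ A B, A.Ground → B.Ground → B.IsMonomial → Entails A B.not →
    (itp A B).1.IsClause ∧ (itp A B).1.Ground
  consts_sub : ∀ A B, A.Ground → B.Ground → B.IsMonomial → Entails A B.not →
    (itp A B).2 ⊆ B.consts \ A.consts ∧
    (itp A B).1.consts ⊆ (A.consts ∩ B.consts) ∪ (itp A B).2
  /-- `A ⇒ ∀ U · φ` -/
  left : ∀ A B, A.Ground → B.Ground → B.IsMonomial → Entails A B.not →
    ∀ M M', Models M A → AgreeOff (itp A B).2 M M' → Models M' (itp A B).1
  right : ∀ A B, A.Ground → B.Ground → B.IsMonomial → Entails A B.not →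
    Entails (itp A B).1 B.not

/-! ## Proof obligations and the quantified trace -/

/-- A proof obligation `⟨m, σ, i⟩`. -/
structure POB (X : Srt → Type u) where
  body : Formula X
  inst : Subst X
  level : ℕ

/-- An element `(ℓ, σ)` of a frame: the lemma `∀ ℓ` and its ground instance `ℓσ`. -/
structure FrameLemma (X : Srt → Type u) where
  body : Formula X
  inst : Subst X

/-- A frame. It is a finite set, listed in some order. -/
abbrev Frame (X : Srt → Type u) : Type u := List (FrameLemma X)

/-- A trace `Q₀, Q₁, …`. -/
abbrev Trace (X : Srt → Type u) : Type u := ℕ → Frame X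

/-- `qi(Q)`: the conjunction of the instances in a frame. -/
def qi {X : Srt → Type u} (Q : Frame X) : Formula X :=
  Formula.conj (Q.map fun l => l.body.subst l.inst)

/-- `∀Q`: the set of (closed) lemmas of a frame. -/
def allQ {X : Srt → Type u} (Q : Frame X) : Set (Formula X) :=
  {φ | ∃ l ∈ Q, φ = l.body.closure}

/-- Adding a lemma to all frames `Q_j` with `j ≤ i`. -/
def Trace.add {X : Srt → Type u} (Q : Trace X) (i : ℕ) (l : FrameLemma X) : Trace X :=
  fun j => if j ≤ i then l :: Q j else Q j

/-- `𝓕(A) = (A(X) ∧ Tr(X,X')) ∨ Init(X')`. -/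
def SafetyProblem.fwd {X : Srt → Type u} (P : SafetyProblem X) (A : Formula X) : Formula X :=
  (A.and P.tr).or P.init.prime

/-- `Tr ∧ m'_sk`. -/
def SafetyProblem.preFormula {X : Srt → Type u} (P : SafetyProblem X) (m : Formula X) : Formula X :=
  P.tr.and m.prime.skolem

/-- The result of model based projection in the **Predecessor** rule. -/
def SafetyProblem.project {X : Srt → Type u} (P : SafetyProblem X) (B : MBP X)
    (m : Formula X) (M : Struct X) : Formula X × Set (AnyConst X) :=
  B.mbp (nxtSet X ∪ skSet X) (P.preFormula m) M

/-- The predecessor at level `i` of a proof obligation with formula `m`, from the model `M`. -/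
def SafetyProblem.predecessor {X : Srt → Type u} (P : SafetyProblem X) (B : MBP X)
    (A : Abstraction X) (m : Formula X) (M : Struct X) (i : ℕ) : POB X :=
  ⟨(A.abs (P.project B m M).2 (P.project B m M).1).1,
   (A.abs (P.project B m M).2 (P.project B m M).1).2, i⟩

/-- The formulas of the proof obligations that arise from `Bad` by taking predecessors. -/
inductive SafetyProblem.Arises {X : Srt → Type u} (P : SafetyProblem X) (B : MBP X)
    (A : Abstraction X) : Formula X → Prop
  | bad : P.Arises B A P.bad
  | pred (m : Formula X) (M : Struct X) (i : ℕ) :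
      P.Arises B A m → Models M (P.preFormula m) →
      P.Arises B A (P.predecessor B A m M i).body

/-- The projection eliminates all constants of sort array, in the projections that can arise in
the given safety problem. -/
def SafetyProblem.EliminatesArrays {X : Srt → Type u} (P : SafetyProblem X) (B : MBP X)
    (A : Abstraction X) : Prop :=
  ∀ m M, P.Arises B A m → Models M (P.preFormula m) →
    ∀ c ∈ (P.project B m M).2, c.1 = Srt.int

/-- The lemma `ℓ` that blocks the formula `m` over a frame `Q` (before quantified generalization):
`L' = Itp(qi(Q) ∧ Tr, m'_sk)` and `(ℓ, _) = abs(SK, L)`. -/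
def SafetyProblem.blockingLemma {X : Srt → Type u} (P : SafetyProblem X) (I : Interpolation X)
    (A : Abstraction X) (Q : Frame X) (m : Formula X) : Formula X :=
  (A.abs (skSet X) (I.itp ((qi Q).and P.tr) m.prime.skolem).1.unprime).1

/-- `c = (g, σ)` is a candidate for the quantified generalization of `(ℓ, ξ)`: `gσ ≡ ℓξ` and
`FVars(ℓ) ⊆ FVars(g)` (with `g` quantifier free over the program variables and variables, and `gσ`
ground). -/
def QGenCandidate {X : Srt → Type u} (ℓ : Formula X) (ξ : Subst X) (c : FrameLemma X) : Prop :=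
  c.body.QF ∧ c.body.consts ⊆ curSet X ∧ (∀ i ∈ c.body.fvars, i ∈ c.inst.dom) ∧
  c.inst.IsGround ∧ Equivalent (c.body.subst c.inst) (ℓ.subst ξ) ∧ ℓ.fvars ⊆ c.body.fvars

/-- `c = (φ, σ)` may be considered for pushing from frame `Q` to frame `Q'`: some `(φ ∨ ψ, σ)` is in
`Q`, and `(φ, σ)` is not in `Q'`. -/
def Pushable {X : Srt → Type u} (Q Q' : Frame X) (c : FrameLemma X) : Prop :=
  (∃ l ∈ Q, l.inst = c.inst ∧ c.body.SubDisj l.body) ∧ c ∉ Q'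

/-- The query deciding whether `φ` is pushed from frame `Q`: the quantified formulas `∀φ` and `∀Q`
are replaced by their instances under the finitely many substitutions `ρs`. The variables of `¬φ'`
are free, hence implicitly Skolemized. -/
def SafetyProblem.pushQuery {X : Srt → Type u} (P : SafetyProblem X) (Q : Frame X)
    (ρs : List (Subst X)) (φ : Formula X) : Formula X :=
  Formula.conj
    [Formula.conj (ρs.map fun ρ => φ.subst ρ),
     Formula.conj (Q.map fun l => Formula.conj (ρs.map fun ρ => l.body.subst ρ)),
     qi Q, P.tr, φ.prime.not]

/-! ## `Quic3_Main` -/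

inductive Result : Type
  | safe
  | cex

/-- Control locations of the procedure, with the local data. -/
inductive Control (X : Srt → Type u) : Type u
  /-- before the test of `Init ∧ Bad` -/
  | start
  /-- head of the main loop -/
  | loop
  /-- head of the loop of `Quic3_MakeSafe`, with the queue of proof obligations -/
  | makeSafe (queue : Set (POB X))
  /-- the proof obligation `p` was just removed, `(ℓ, p.inst)` is the lemma that blocks it;
  `cands` are the generalizations that remain to be tried -/
  | qgen (queue : Set (POB X)) (p : POB X) (ℓ : Formula X) (cands : List (FrameLemma X))
  /-- `Quic3_Push`, about to push from frame `i` -/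
  | push (i : ℕ)
  /-- pushing from frame `i`, with the instantiations used and the candidates that remain -/
  | pushing (i : ℕ) (ρs : List (Subst X)) (cands : List (FrameLemma X))
  /-- the procedure has returned -/
  | ret (r : Result)
  /-- waiting for a call to the solver that never returns -/
  | hang

structure Config (X : Srt → Type u) where
  /-- the level -/
  N : ℕ
  trace : Trace X
  ctrl : Control X

/-- `N ← 0; Q₀ = {(Init, ∅)}`. -/
def SafetyProblem.initial {X : Srt → Type u} (P : SafetyProblem X) : Config X :=
  ⟨0, fun i => if i = 0 then [⟨P.init, Subst.empty⟩] else [], .start⟩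

/-- `p` may be returned by `Top`: the queue is ordered by level, lowest level first. -/
def IsTop {X : Srt → Type u} (queue : Set (POB X)) (p : POB X) : Prop :=
  p ∈ queue ∧ ∀ q ∈ queue, p.level ≤ q.level

/-- The condition of the **Safe** rule. -/
def SafeCond {X : Srt → Type u} (N : ℕ) (Q : Trace X) : Prop :=
  ∃ i < N, allQ (Q i) ⊆ allQ (Q (i + 1))

/-- The steps of `Quic3_Main`. Heuristic choices (which generalizations of a lemma to try, which
lemmas to push, and which finite set of instantiations to use) are arbitrary, and so is the model
that the solver returns. -/
inductive Step {X : Srt → Type u} (P : SafetyProblem X) (S : Solver X) (B : MBP X)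
    (I : Interpolation X) (A : Abstraction X) : Config X → Config X → Prop
  -- main procedure
  | start_sat (N Q M) : S.call (P.init.and P.bad) (.sat M) →
      Step P S B I A ⟨N, Q, .start⟩ ⟨N, Q, .ret .cex⟩
  | start_unsat (N Q) : S.call (P.init.and P.bad) .unsat →
      Step P S B I A ⟨N, Q, .start⟩ ⟨N, Q, .loop⟩
  | start_hang (N Q) : S.call (P.init.and P.bad) .diverges →
      Step P S B I A ⟨N, Q, .start⟩ ⟨N, Q, .hang⟩
  | unfold (N Q) :
      Step P S B I A ⟨N, Q, .loop⟩
        ⟨N + 1, Function.update Q (N + 1) [],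
          .makeSafe {⟨P.bad, Subst.empty, N + 1⟩}⟩
  -- blocking phase
  | blocked (N Q) : Step P S B I A ⟨N, Q, .makeSafe ∅⟩ ⟨N, Q, .push 0⟩
  | cex (N Q queue p) : IsTop queue p → p.level = 0 →
      Step P S B I A ⟨N, Q, .makeSafe queue⟩ ⟨N, Q, .ret .cex⟩
  | predecessor (N Q queue p i M) : IsTop queue p → p.level = i + 1 →
      S.call ((qi (Q i)).and (P.preFormula p.body)) (.sat M) →
      Step P S B I A ⟨N, Q, .makeSafe queue⟩
        ⟨N, Q, .makeSafe (insert (P.predecessor B A p.body M i) queue)⟩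
  | block (N Q queue p i cands) : IsTop queue p → p.level = i + 1 →
      S.call ((qi (Q i)).and (P.preFormula p.body)) .unsat →
      (∀ c ∈ cands, QGenCandidate (P.blockingLemma I A (Q i) p.body) p.inst c) →
      Step P S B I A ⟨N, Q, .makeSafe queue⟩
        ⟨N, Q, .qgen (queue \ {p}) p (P.blockingLemma I A (Q i) p.body) cands⟩
  | block_hang (N Q queue p i) : IsTop queue p → p.level = i + 1 →
      S.call ((qi (Q i)).and (P.preFormula p.body)) .diverges →
      Step P S B I A ⟨N, Q, .makeSafe queue⟩ ⟨N, Q, .hang⟩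
  -- quantified generalization and addition of the new lemma
  | qgen_none (N Q queue p ℓ) :
      Step P S B I A ⟨N, Q, .qgen queue p ℓ []⟩
        ⟨N, Trace.add Q p.level ⟨ℓ, p.inst⟩, .makeSafe queue⟩
  | qgen_ok (N Q queue p ℓ c cs) :
      S.call ((P.fwd (qi (Q (p.level - 1)))).and c.body.prime.not) .unsat →
      Step P S B I A ⟨N, Q, .qgen queue p ℓ (c :: cs)⟩
        ⟨N, Trace.add Q p.level c, .makeSafe queue⟩
  | qgen_fail (N Q queue p ℓ c cs M) :
      S.call ((P.fwd (qi (Q (p.level - 1)))).and c.body.prime.not) (.sat M) →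
      Step P S B I A ⟨N, Q, .qgen queue p ℓ (c :: cs)⟩ ⟨N, Q, .qgen queue p ℓ cs⟩
  | qgen_hang (N Q queue p ℓ c cs) :
      S.call ((P.fwd (qi (Q (p.level - 1)))).and c.body.prime.not) .diverges →
      Step P S B I A ⟨N, Q, .qgen queue p ℓ (c :: cs)⟩ ⟨N, Q, .hang⟩
  -- pushing phase
  | push_frame (N Q i ρs cands) : i < N →
      Step P S B I A ⟨N, Q, .push i⟩ ⟨N, Q, .pushing i ρs cands⟩
  | push_safe (N Q i) : N ≤ i → SafeCond N Q →
      Step P S B I A ⟨N, Q, .push i⟩ ⟨N, Q, .ret .safe⟩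
  | push_done (N Q i) : N ≤ i → ¬ SafeCond N Q →
      Step P S B I A ⟨N, Q, .push i⟩ ⟨N, Q, .loop⟩
  | pushing_nil (N Q i ρs) :
      Step P S B I A ⟨N, Q, .pushing i ρs []⟩ ⟨N, Q, .push (i + 1)⟩
  | pushing_skip (N Q i ρs c cs) : ¬ Pushable (Q i) (Q (i + 1)) c →
      Step P S B I A ⟨N, Q, .pushing i ρs (c :: cs)⟩ ⟨N, Q, .pushing i ρs cs⟩
  | pushing_init_fail (N Q i ρs c cs M) : Pushable (Q i) (Q (i + 1)) c →
      S.call (P.init.and c.body.not) (.sat M) →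
      Step P S B I A ⟨N, Q, .pushing i ρs (c :: cs)⟩ ⟨N, Q, .pushing i ρs cs⟩
  | pushing_init_hang (N Q i ρs c cs) : Pushable (Q i) (Q (i + 1)) c →
      S.call (P.init.and c.body.not) .diverges →
      Step P S B I A ⟨N, Q, .pushing i ρs (c :: cs)⟩ ⟨N, Q, .hang⟩
  | pushing_fail (N Q i ρs c cs M) : Pushable (Q i) (Q (i + 1)) c →
      S.call (P.init.and c.body.not) .unsat →
      S.call (P.pushQuery (Q i) ρs c.body) (.sat M) →
      Step P S B I A ⟨N, Q, .pushing i ρs (c :: cs)⟩ ⟨N, Q, .pushing i ρs cs⟩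
  | pushing_hang (N Q i ρs c cs) : Pushable (Q i) (Q (i + 1)) c →
      S.call (P.init.and c.body.not) .unsat →
      S.call (P.pushQuery (Q i) ρs c.body) .diverges →
      Step P S B I A ⟨N, Q, .pushing i ρs (c :: cs)⟩ ⟨N, Q, .hang⟩
  | pushing_ok (N Q i ρs c cs) : Pushable (Q i) (Q (i + 1)) c →
      S.call (P.init.and c.body.not) .unsat →
      S.call (P.pushQuery (Q i) ρs c.body) .unsat →
      Step P S B I A ⟨N, Q, .pushing i ρs (c :: cs)⟩
        ⟨N, Trace.add Q (i + 1) c, .pushing i ρs cs⟩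
  -- a call that does not return
  | hang (N Q) : Step P S B I A ⟨N, Q, .hang⟩ ⟨N, Q, .hang⟩

/-- A maximal run of `Quic3_Main`, as an infinite sequence: it goes on as long as a step is
possible, and its last configuration (if any) is repeated forever. -/
def IsRun {X : Srt → Type u} (P : SafetyProblem X) (S : Solver X) (B : MBP X)
    (I : Interpolation X) (A : Abstraction X) (run : ℕ → Config X) : Prop :=
  run 0 = P.initial ∧
  ∀ n, Step P S B I A (run n) (run (n + 1)) ∨
    ((¬ ∃ c, Step P S B I A (run n) c) ∧ run (n + 1) = run n)

end Quic3

namespace Quic3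

variable {X : Srt → Type*}

/-! ## Semantics of terms and formulas -/

/-! While the level stays fixed, a rank decreases in a well-founded order, so the run must return or
raise the level by exactly one; induction on the level then gives the theorem.

No solver call hangs. Frame lemmas are quantifier free with ground instances, and proof obligations
are cubes over the program variables, so every query is quantifier free. `Step.inv` preserves these
facts, and `Config.Inv.exists_step` shows that only a returned configuration can be stuck.

The blocking phase ends because only finitely many obligations exist at level `N`: depth is at most
`N`, and each obligation has finitely many projections (`SafetyProblem.finite_allPobs`). A
predecessor is lower than everything in the queue, hence new. Its instance holds in the model that
produced it, so the current frame does not block it (`not_blocked_predecessor`). Conversely, the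
lemma added for a removed obligation blocks its instance, and frames only grow while the level is
fixed. So the set of obligations neither queued nor blocked shrinks with each predecessor, and is
not enlarged by removing and then blocking an obligation. Twice its size plus the size of the queue
measures the phase; `Config.rank` combines this lexicographically with the phase and the number of
remaining candidates.

A returned counterexample is genuine: an obligation at depth `d` holds only in states from which
`Bad` is reached in `d` steps. Level `0` forces `d = N`, and since `Init` belongs to `Q 0`, an
obligation created there meets the initial states. No over-approximation property of the frames
enters the argument. -/

theorem Term.eval_congr {M M' : Struct X} {e e' : Env} {s : Srt} (t : Term X s)
    (hc : ∀ s (c : Const X s), (⟨s, c⟩ : AnyConst X) ∈ t.consts → M s c = M' s c)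
    (he : ∀ i ∈ t.fvars, e i = e' i) : t.eval M e = t.eval M' e' := by
  induction t with
  | var i => exact he i (by simp [Term.fvars])
  | con c => exact hc _ c (by simp [Term.consts])
  | num n => rfl
  | _ =>
    simp only [Term.consts, Term.fvars, Set.mem_union, Finset.mem_union] at hc he
    simp_all [Term.eval]

theorem Formula.sat_congr {M M' : Struct X} {e e' : Env} (φ : Formula X)
    (hc : ∀ s (c : Const X s), (⟨s, c⟩ : AnyConst X) ∈ φ.consts → M s c = M' s c)
    (he : ∀ i ∈ φ.fvars, e i = e' i) : φ.Sat M e ↔ φ.Sat M' e' := by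
  induction φ generalizing e e' with
  | tru => rfl
  | fls => rfl
  | lt a b =>
    simp only [Formula.consts, Formula.fvars, Set.mem_union, Finset.mem_union] at hc he
    simp only [Formula.Sat]
    rw [a.eval_congr (fun s c h => hc s c (.inl h)) (fun i h => he i (.inl h)),
      b.eval_congr (fun s c h => hc s c (.inr h)) (fun i h => he i (.inr h))]
  | le a b =>
    simp only [Formula.consts, Formula.fvars, Set.mem_union, Finset.mem_union] at hc he
    simp only [Formula.Sat]
    rw [a.eval_congr (fun s c h => hc s c (.inl h)) (fun i h => he i (.inl h)),
      b.eval_congr (fun s c h => hc s c (.inr h)) (fun i h => he i (.inr h))]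
  | eq a b =>
    simp only [Formula.consts, Formula.fvars, Set.mem_union, Finset.mem_union] at hc he
    simp only [Formula.Sat]
    rw [a.eval_congr (fun s c h => hc s c (.inl h)) (fun i h => he i (.inl h)),
      b.eval_congr (fun s c h => hc s c (.inr h)) (fun i h => he i (.inr h))]
  | not φ ih => exact not_congr (ih hc he)
  | and φ ψ ih₁ ih₂ =>
    simp only [Formula.consts, Formula.fvars, Set.mem_union, Finset.mem_union] at hc he
    exact and_congr (ih₁ (fun s c h => hc s c (.inl h)) (fun i h => he i (.inl h)))
      (ih₂ (fun s c h => hc s c (.inr h)) (fun i h => he i (.inr h)))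
  | or φ ψ ih₁ ih₂ =>
    simp only [Formula.consts, Formula.fvars, Set.mem_union, Finset.mem_union] at hc he
    exact or_congr (ih₁ (fun s c h => hc s c (.inl h)) (fun i h => he i (.inl h)))
      (ih₂ (fun s c h => hc s c (.inr h)) (fun i h => he i (.inr h)))
  | all j φ ih =>
    refine forall_congr' fun n => ih hc fun i hi => ?_
    by_cases h : i = j
    · subst h; simp
    · simp only [Function.update_of_ne h]
      exact he i (by simp [Formula.fvars, h, hi])

theorem Formula.Ground.sat_congr {M M' : Struct X} {φ : Formula X} (hφ : φ.Ground) (e e' : Env)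
    (hc : ∀ s (c : Const X s), (⟨s, c⟩ : AnyConst X) ∈ φ.consts → M s c = M' s c) :
    φ.Sat M e ↔ φ.Sat M' e' :=
  φ.sat_congr hc (by simp [hφ.2])

/-- The solver supplies a single assignment, whereas projection asks for truth under all of them;
for ground formulas the two agree. -/
theorem Formula.Ground.models_of_sat {M : Struct X} {φ : Formula X} (hφ : φ.Ground) {e : Env}
    (h : φ.Sat M e) : Models M φ :=
  fun e' => (hφ.sat_congr e' e fun _ _ _ => rfl).2 h

/-! ## Substitution -/

/-- The assignment that `σ` induces from the structure `M` and the assignment `e`. -/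
def Subst.env (σ : Subst X) (M : Struct X) (e : Env) : Env :=
  fun i => ((σ i).getD (.var i)).eval M e

theorem Term.eval_subst (σ : Subst X) (M : Struct X) (e : Env) {s : Srt} (t : Term X s) :
    (t.subst σ).eval M e = t.eval M (σ.env M e) := by
  induction t with
  | var i => rfl
  | _ => simp_all [Term.eval, Term.subst]

theorem Formula.sat_subst (σ : Subst X) (M : Struct X) (e : Env) {φ : Formula X} (hφ : φ.QF) :
    (φ.subst σ).Sat M e ↔ φ.Sat M (σ.env M e) := by
  induction φ with
  | all i φ => exact hφ.elim
  | not φ ih => exact not_congr (ih hφ)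
  | and φ ψ ih₁ ih₂ => exact and_congr (ih₁ hφ.1) (ih₂ hφ.2)
  | or φ ψ ih₁ ih₂ => exact or_congr (ih₁ hφ.1) (ih₂ hφ.2)
  | _ => simp [Formula.Sat, Formula.subst, Term.eval_subst]

theorem Formula.qf_subst (σ : Subst X) {φ : Formula X} : (φ.subst σ).QF ↔ φ.QF := by
  induction φ generalizing σ with
  | _ => simp_all [Formula.QF, Formula.subst]

theorem Formula.isAtom_subst (σ : Subst X) {φ : Formula X} : (φ.subst σ).IsAtom ↔ φ.IsAtom := by
  cases φ <;> simp [Formula.IsAtom, Formula.subst]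

theorem Formula.isMonomial_subst (σ : Subst X) {φ : Formula X} :
    (φ.subst σ).IsMonomial ↔ φ.IsMonomial := by
  induction φ with
  | not φ ih => exact Formula.isAtom_subst σ
  | _ => simp_all [Formula.IsMonomial, Formula.IsLit, Formula.subst, Formula.IsAtom]

theorem Term.consts_subset_subst (σ : Subst X) {s : Srt} (t : Term X s) :
    t.consts ⊆ (t.subst σ).consts := by
  induction t with
  | var i => simp [Term.consts]
  | _ => simp only [Term.consts, Term.subst]; gcongr

theorem Formula.consts_subset_subst (σ : Subst X) (φ : Formula X) :
    φ.consts ⊆ (φ.subst σ).consts := by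
  induction φ generalizing σ with
  | lt a b => exact Set.union_subset_union (a.consts_subset_subst σ) (b.consts_subset_subst σ)
  | le a b => exact Set.union_subset_union (a.consts_subset_subst σ) (b.consts_subset_subst σ)
  | eq a b => exact Set.union_subset_union (a.consts_subset_subst σ) (b.consts_subset_subst σ)
  | not φ ih => exact ih σ
  | and φ ψ ih₁ ih₂ => exact Set.union_subset_union (ih₁ σ) (ih₂ σ)
  | or φ ψ ih₁ ih₂ => exact Set.union_subset_union (ih₁ σ) (ih₂ σ)
  | all i φ ih => exact ih _
  | _ => exact Set.Subset.rfl

/-- The exact description is needed in both directions: to bound the constants of a skolemized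
formula, and to show that a constant substituted for an occurring variable does occur. -/
theorem Term.mem_consts_subst {σ : Subst X} {s : Srt} {t : Term X s} {c : AnyConst X} :
    c ∈ (t.subst σ).consts ↔
      c ∈ t.consts ∨ ∃ i ∈ t.fvars, ∃ u, σ i = some u ∧ c ∈ u.consts := by
  induction t with
  | var i => cases h : σ i <;> simp [Term.consts, Term.subst, Term.fvars, h]
  | con c => simp [Term.consts, Term.subst, Term.fvars]
  | num n => simp [Term.consts, Term.subst, Term.fvars]
  | _ =>
    simp only [Term.consts, Term.subst, Term.fvars, Set.mem_union, Finset.mem_union, *, or_and_right,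
      exists_or, or_assoc, or_left_comm]

theorem Formula.mem_consts_subst {σ : Subst X} {φ : Formula X} (hφ : φ.QF) {c : AnyConst X} :
    c ∈ (φ.subst σ).consts ↔
      c ∈ φ.consts ∨ ∃ i ∈ φ.fvars, ∃ u, σ i = some u ∧ c ∈ u.consts := by
  induction φ with
  | all i φ => exact hφ.elim
  | not φ ih => exact ih hφ
  | and φ ψ ih₁ ih₂ =>
    simp only [Formula.consts, Formula.subst, Formula.fvars, Set.mem_union, Finset.mem_union,
      ih₁ hφ.1, ih₂ hφ.2, or_and_right, exists_or, or_assoc,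
      or_left_comm]
  | or φ ψ ih₁ ih₂ =>
    simp only [Formula.consts, Formula.subst, Formula.fvars, Set.mem_union, Finset.mem_union,
      ih₁ hφ.1, ih₂ hφ.2, or_and_right, exists_or, or_assoc,
      or_left_comm]
  | tru => simp [Formula.consts, Formula.subst, Formula.fvars]
  | fls => simp [Formula.consts, Formula.subst, Formula.fvars]
  | _ =>
    simp only [Formula.consts, Formula.subst, Formula.fvars, Set.mem_union, Finset.mem_union,
      Term.mem_consts_subst, or_and_right, exists_or, or_assoc,
      or_left_comm]

theorem Term.fvars_subst_eq_empty {σ : Subst X} (hσ : σ.IsGround) {s : Srt} {t : Term X s}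
    (ht : ∀ i ∈ t.fvars, i ∈ σ.dom) : (t.subst σ).fvars = ∅ := by
  induction t with
  | var i =>
    have := ht i (by simp [Term.fvars])
    obtain ⟨u, hu⟩ := Option.isSome_iff_exists.1 this
    simp [Term.subst, hu, hσ i u hu]
  | con c => rfl
  | num n => rfl
  | _ =>
    simp only [Term.fvars, Finset.mem_union] at ht
    simp_all [Term.fvars, Term.subst]

theorem Formula.fvars_subst_eq_empty {σ : Subst X} (hσ : σ.IsGround) {φ : Formula X} (hφ : φ.QF)
    (h : ∀ i ∈ φ.fvars, i ∈ σ.dom) : (φ.subst σ).fvars = ∅ := by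
  induction φ with
  | all i φ => exact hφ.elim
  | not φ ih => exact ih hφ h
  | tru => rfl
  | fls => rfl
  | and φ ψ ih₁ ih₂ =>
    simp only [Formula.fvars, Finset.mem_union] at h
    simp [Formula.fvars, Formula.subst, ih₁ hφ.1 fun i hi => h i (.inl hi),
      ih₂ hφ.2 fun i hi => h i (.inr hi)]
  | or φ ψ ih₁ ih₂ =>
    simp only [Formula.fvars, Finset.mem_union] at h
    simp [Formula.fvars, Formula.subst, ih₁ hφ.1 fun i hi => h i (.inl hi),
      ih₂ hφ.2 fun i hi => h i (.inr hi)]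
  | _ =>
    simp only [Formula.fvars, Finset.mem_union] at h
    simp [Formula.fvars, Formula.subst, Term.fvars_subst_eq_empty hσ fun i hi => h i (.inl hi),
      Term.fvars_subst_eq_empty hσ fun i hi => h i (.inr hi)]

theorem Term.subst_empty {s : Srt} (t : Term X s) : t.subst Subst.empty = t := by
  induction t with
  | var i => rfl
  | _ => simp_all [Term.subst]

theorem Formula.subst_empty {φ : Formula X} : φ.subst Subst.empty = φ := by
  induction φ with
  | all i φ ih =>
    have : Function.update (Subst.empty (X := X)) i none = Subst.empty := by
      simp [Subst.empty]
    simp [Formula.subst, this, ih]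
  | _ => simp_all [Formula.subst, Term.subst_empty]

/-! ## Renaming of constants -/

theorem Term.eval_mapC (f : ∀ s, Const X s → Const X s) (M : Struct X) (e : Env) {s : Srt}
    (t : Term X s) : (t.mapC f).eval M e = t.eval (fun s c => M s (f s c)) e := by
  induction t with
  | _ => simp_all [Term.eval, Term.mapC]

theorem Formula.sat_mapC (f : ∀ s, Const X s → Const X s) (M : Struct X) (e : Env)
    (φ : Formula X) : (φ.mapC f).Sat M e ↔ φ.Sat (fun s c => M s (f s c)) e := by
  induction φ generalizing e with
  | _ => simp_all [Formula.Sat, Formula.mapC, Term.eval_mapC]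

theorem Formula.qf_mapC (f : ∀ s, Const X s → Const X s) {φ : Formula X} :
    (φ.mapC f).QF ↔ φ.QF := by
  induction φ with
  | _ => simp_all [Formula.QF, Formula.mapC]

theorem Formula.isAtom_mapC (f : ∀ s, Const X s → Const X s) {φ : Formula X} :
    (φ.mapC f).IsAtom ↔ φ.IsAtom := by
  cases φ <;> simp [Formula.IsAtom, Formula.mapC]

theorem Formula.isMonomial_mapC (f : ∀ s, Const X s → Const X s) {φ : Formula X} :
    (φ.mapC f).IsMonomial ↔ φ.IsMonomial := by
  induction φ with
  | not φ ih => exact Formula.isAtom_mapC f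
  | _ => simp_all [Formula.IsMonomial, Formula.IsLit, Formula.mapC, Formula.IsAtom]

theorem Term.fvars_mapC (f : ∀ s, Const X s → Const X s) {s : Srt} (t : Term X s) :
    (t.mapC f).fvars = t.fvars := by
  induction t with
  | _ => simp_all [Term.fvars, Term.mapC]

theorem Formula.fvars_mapC (f : ∀ s, Const X s → Const X s) (φ : Formula X) :
    (φ.mapC f).fvars = φ.fvars := by
  induction φ with
  | _ => simp_all [Formula.fvars, Formula.mapC, Term.fvars_mapC]

theorem Formula.Ground.mapC (f : ∀ s, Const X s → Const X s) {φ : Formula X} (hφ : φ.Ground) :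
    (φ.mapC f).Ground :=
  ⟨(Formula.qf_mapC f).2 hφ.1, (φ.fvars_mapC f).trans hφ.2⟩

theorem Term.consts_mapC (f : ∀ s, Const X s → Const X s) {s : Srt} (t : Term X s) :
    (t.mapC f).consts = (fun c : AnyConst X => (⟨c.1, f c.1 c.2⟩ : AnyConst X)) '' t.consts := by
  induction t with
  | _ => simp_all [Term.consts, Term.mapC, Set.image_union]

theorem Formula.consts_mapC (f : ∀ s, Const X s → Const X s) (φ : Formula X) :
    (φ.mapC f).consts = (fun c : AnyConst X => (⟨c.1, f c.1 c.2⟩ : AnyConst X)) '' φ.consts := by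
  induction φ with
  | _ => simp_all [Formula.consts, Formula.mapC, Set.image_union, Term.consts_mapC]

/-! ## Finite conjunctions and disjuncts -/

theorem Formula.sat_conj {M : Struct X} {e : Env} (l : List (Formula X)) :
    (Formula.conj l).Sat M e ↔ ∀ φ ∈ l, φ.Sat M e := by
  induction l with
  | nil => simp [Formula.conj, Formula.Sat]
  | cons φ l ih =>
    simp only [Formula.conj, List.foldr_cons, Formula.Sat, List.forall_mem_cons] at ih ⊢
    rw [ih]

theorem Formula.qf_conj {l : List (Formula X)} : (Formula.conj l).QF ↔ ∀ φ ∈ l, φ.QF := by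
  induction l with
  | nil => simp [Formula.conj, Formula.QF]
  | cons φ l ih =>
    simp only [Formula.conj, List.foldr_cons, Formula.QF, List.forall_mem_cons] at ih ⊢
    rw [ih]

theorem Formula.fvars_conj_eq_empty {l : List (Formula X)} (h : ∀ φ ∈ l, φ.fvars = ∅) :
    (Formula.conj l).fvars = ∅ := by
  induction l with
  | nil => simp [Formula.conj, Formula.fvars]
  | cons φ l ih =>
    simp only [List.forall_mem_cons] at h
    have := ih h.2
    simp only [Formula.conj, List.foldr_cons, Formula.fvars] at this ⊢
    rw [this, h.1, Finset.union_empty]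

/-- `SubDisj` compares lists of disjuncts only, so what pushing inherits from a lemma must be read
off disjunct by disjunct. Dropping `fls` is harmless, as it has neither quantifiers nor variables.
-/
theorem Formula.qf_iff_disjuncts {φ : Formula X} : φ.QF ↔ ∀ χ ∈ φ.disjuncts, χ.QF := by
  induction φ with
  | or φ ψ ih₁ ih₂ =>
    simp only [Formula.QF, Formula.disjuncts, List.mem_append, or_imp, forall_and]
    rw [ih₁, ih₂]
  | _ => simp [Formula.QF, Formula.disjuncts]

theorem Formula.mem_fvars_iff_disjuncts {φ : Formula X} {i : ℕ} :
    i ∈ φ.fvars ↔ ∃ χ ∈ φ.disjuncts, i ∈ χ.fvars := by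
  induction φ with
  | or φ ψ ih₁ ih₂ =>
    simp only [Formula.fvars, Formula.disjuncts, List.mem_append, Finset.mem_union, ih₁, ih₂,
      or_and_right, exists_or]
  | _ => simp [Formula.fvars, Formula.disjuncts]

theorem Formula.SubDisj.qf {φ χ : Formula X} (h : φ.SubDisj χ) (hχ : χ.QF) : φ.QF :=
  Formula.qf_iff_disjuncts.2 fun _ hψ => Formula.qf_iff_disjuncts.1 hχ _ (h hψ)

theorem Formula.SubDisj.fvars {φ χ : Formula X} (h : φ.SubDisj χ) : φ.fvars ⊆ χ.fvars := by
  intro i hi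
  obtain ⟨ψ, hψ, hi⟩ := Formula.mem_fvars_iff_disjuncts.1 hi
  exact Formula.mem_fvars_iff_disjuncts.2 ⟨ψ, h hψ, hi⟩

/-! ## Proof obligations -/

theorem isGround_skSubst : (skSubst (X := X)).IsGround := by
  intro i t h
  cases h
  rfl

theorem Formula.QF.ground_skolem {φ : Formula X} (hφ : φ.QF) : φ.skolem.Ground :=
  ⟨(Formula.qf_subst _).2 hφ, Formula.fvars_subst_eq_empty isGround_skSubst hφ fun _ _ => rfl⟩

theorem Formula.qf_prime {φ : Formula X} : φ.prime.QF ↔ φ.QF := Formula.qf_mapC _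

theorem Formula.Ground.and {φ ψ : Formula X} (hφ : φ.Ground) (hψ : ψ.Ground) : (φ.and ψ).Ground :=
  ⟨⟨hφ.1, hψ.1⟩, by simp [Formula.fvars, hφ.2, hψ.2]⟩

theorem Formula.QF.ground_prime_skolem {m : Formula X} (hm : m.QF) : m.prime.skolem.Ground :=
  Formula.QF.ground_skolem (Formula.qf_prime.2 hm)

theorem SafetyProblem.preFormula_ground (P : SafetyProblem X) {m : Formula X} (hm : m.QF) :
    (P.preFormula m).Ground :=
  P.tr_ground.and hm.ground_prime_skolem

/-- Semantically, priming moves evaluation to the post-state and skolemizing reads the assignment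
off the Skolem constants. -/
theorem Formula.sat_prime_skolem {m : Formula X} (hm : m.QF) {M : Struct X} {e : Env} :
    m.prime.skolem.Sat M e ↔
      m.Sat (fun s c => M s (Const.prime s c)) (fun i => M Srt.int (.sk i)) := by
  rw [Formula.skolem, Formula.sat_subst _ _ _ (Formula.qf_prime.2 hm), Formula.prime,
    Formula.sat_mapC]
  rfl

/-- The properties of the formula of a proof obligation that do not depend on the problem. -/
structure Formula.IsCube (m : Formula X) : Prop where
  isMonomial : m.IsMonomial
  qf : m.QF
  consts_subset : m.consts ⊆ curSet X

/-- What an abstraction returns on a ground formula, spelled out for later use. -/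
structure AbstractionSpec (U : Set (AnyConst X)) (φ : Formula X) (r : Formula X × Subst X) :
    Prop where
  subst_eq : r.1.subst r.2 = φ
  qf : r.1.QF
  exists_const : ∀ i ∈ r.1.fvars, ∃ c : Const X Srt.int,
    (⟨Srt.int, c⟩ : AnyConst X) ∈ U ∧ r.2 i = some (.con c)
  const_mem : ∀ i (c : Const X Srt.int), r.2 i = some (.con c) → (⟨Srt.int, c⟩ : AnyConst X) ∈ U
  isGround : r.2.IsGround
  injective : ∀ i j t, r.2 i = some t → r.2 j = some t → i = j
  consts_subset : r.1.consts ⊆ φ.consts \ U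
  sk : ∀ i, (⟨Srt.int, .sk i⟩ : AnyConst X) ∈ U ∩ φ.consts → r.2 i = some (.con (.sk i))

/-- Since the abstracted formula is ground, the substitution is defined on every variable of the
result, and each such variable stands for a constant of `U`. -/
theorem Abstraction.abstractionSpec (A : Abstraction X) {U : Set (AnyConst X)} {φ : Formula X}
    (hφ : φ.Ground) (hU : ∀ c ∈ φ.consts ∩ U, c.1 = Srt.int) :
    AbstractionSpec U φ (A.abs U φ) := by
  obtain ⟨h₁, h₂, h₃, h₄, h₅, h₆⟩ := A.spec U φ hφ hU
  refine ⟨h₁, (Formula.qf_subst _).1 (h₁ ▸ hφ.1), fun i hi => ?_, fun i c h => ?_, fun i t h => ?_,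
    h₅, fun c hc => ⟨?_, fun hcU => Set.disjoint_left.1 h₃ hcU hc⟩, h₆⟩
  · have : i ∈ (A.abs U φ).2.dom := by simp [h₂, hi, hφ.2]
    obtain ⟨t, ht⟩ := Option.isSome_iff_exists.1 this
    obtain ⟨c, hc, rfl⟩ := h₄ i t ht
    exact ⟨c, hc, ht⟩
  · obtain ⟨c', hc', h'⟩ := h₄ i _ h
    cases h'
    exact hc'
  · obtain ⟨c, -, rfl⟩ := h₄ i t h
    rfl
  · have := Formula.consts_subset_subst (A.abs U φ).2 _ hc
    rwa [h₁] at this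

theorem AbstractionSpec.mem_dom {U : Set (AnyConst X)} {φ : Formula X} {r : Formula X × Subst X}
    (h : AbstractionSpec U φ r) {i : ℕ} (hi : i ∈ r.1.fvars) : i ∈ r.2.dom := by
  obtain ⟨c, -, hc⟩ := h.exists_const i hi
  simp [Subst.dom, hc]

open Classical in
/-- An assignment of the variables of an abstraction extends to the abstracted constants. -/
theorem AbstractionSpec.exists_agreeOff {U : Set (AnyConst X)} {φ : Formula X}
    {r : Formula X × Subst X} (h : AbstractionSpec U φ r) {M : Struct X} {e : Env}
    (hs : r.1.Sat M e) : ∃ M', AgreeOff U M M' ∧ φ.Sat M' e := by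
  -- An abstracted integer constant takes the value of the variable standing for it. Injectivity of
  -- the substitution makes the chosen variable the only possible one.
  let M' : Struct X := fun s => match s with
    | .int => fun c => if hc : ∃ i, r.2 i = some (.con c) then e hc.choose else M _ c
    | .arr => fun c => M _ c
  have hM' : AgreeOff U M M' := by
    rintro (_ | _) c hc
    · have : ¬ ∃ i, r.2 i = some (.con c) := fun ⟨i, hi⟩ => hc (h.const_mem i c hi)
      simp [M', this]
    · rfl
  refine ⟨M', hM', ?_⟩
  rw [← h.subst_eq, Formula.sat_subst _ _ _ h.qf]
  refine (r.1.sat_congr (fun s c hc => hM' s c (h.consts_subset hc).2) fun i hi => ?_).1 hs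
  obtain ⟨c, -, hi⟩ := h.exists_const i hi
  have hc : ∃ i, r.2 i = some (.con c) := ⟨i, hi⟩
  have : hc.choose = i := h.injective _ _ _ hc.choose_spec hi
  simp only [Subst.env, hi, Option.getD_some, Term.eval]
  change e i = dite _ _ _
  rw [dif_pos hc, this]

/-! ### Predecessors of proof obligations: shape, finiteness, and reachability of `Bad` -/

section Predecessor

variable {P : SafetyProblem X} {B : MBP X} {A : Abstraction X}

/-- Abstraction can introduce integer variables only; elimination of arrays ensures that the
constants surviving projection are of that sort. -/
theorem SafetyProblem.EliminatesArrays.abstractionSpec (harr : P.EliminatesArrays B A)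
    {m : Formula X} (hA : P.Arises B A m) (hm : m.IsCube) {M : Struct X}
    (hM : Models M (P.preFormula m)) :
    AbstractionSpec (P.project B m M).2 (P.project B m M).1
      (A.abs (P.project B m M).2 (P.project B m M).1) :=
  A.abstractionSpec (B.ground_monomial _ _ _ (P.preFormula_ground hm.qf) hM).2
    fun c hc => harr m M hA hM c hc.2

/-- The Skolem indices are exactly controlled by the variables of `m`; this later confines the
variables of the blocking lemma. -/
theorem Formula.consts_prime_skolem_subset {m : Formula X} (hm : m.QF)
    (hc : m.consts ⊆ curSet X) {c : AnyConst X} (h : c ∈ m.prime.skolem.consts) :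
    c ∈ nxtSet X ∨ ∃ i ∈ m.fvars, c = ⟨Srt.int, .sk i⟩ := by
  rw [Formula.skolem, Formula.mem_consts_subst (Formula.qf_prime.2 hm)] at h
  rcases h with h | ⟨i, hi, u, hu, h⟩
  · rw [Formula.prime, Formula.consts_mapC] at h
    obtain ⟨c, hc', rfl⟩ := h
    obtain ⟨s, x, rfl⟩ := hc hc'
    exact .inl ⟨s, x, rfl⟩
  · cases hu
    rw [Formula.prime, Formula.fvars_mapC] at hi
    exact .inr ⟨i, hi, h⟩

theorem SafetyProblem.preFormula_consts_subset (P : SafetyProblem X) {m : Formula X}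
    (hm : m.IsCube) : (P.preFormula m).consts ⊆ curSet X ∪ (nxtSet X ∪ skSet X) := by
  rintro c (hc | hc)
  · rcases P.tr_consts hc with h | h
    · exact .inl h
    · exact .inr (.inl h)
  · rcases Formula.consts_prime_skolem_subset hm.qf hm.consts_subset hc with h | ⟨i, -, h⟩
    · exact .inr (.inl h)
    · exact .inr (.inr ⟨i, h⟩)

/-- Each primed or Skolem constant is removed either by projection or, if it lies in `W`, by
abstraction, so only program variables remain. Substitution preserves the propositional shape, which
transfers monomiality back from the projection. -/
theorem SafetyProblem.EliminatesArrays.isCube_predecessor (harr : P.EliminatesArrays B A)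
    {m : Formula X} (hA : P.Arises B A m) (hm : m.IsCube) {M : Struct X}
    (hM : Models M (P.preFormula m)) (i : ℕ) : (P.predecessor B A m M i).body.IsCube := by
  have h := harr.abstractionSpec hA hm hM
  refine ⟨?_, h.qf, fun c hc => ?_⟩
  · rw [← Formula.isMonomial_subst (A.abs (P.project B m M).2 (P.project B m M).1).2]
    change (Formula.subst _ (A.abs _ _).1).IsMonomial
    rw [h.subst_eq]
    exact (B.ground_monomial _ _ _ (P.preFormula_ground hm.qf) hM).1
  · obtain ⟨hc, hcW⟩ := h.consts_subset hc
    have := (B.consts_sub _ _ _ (P.preFormula_ground hm.qf) hM).2 hc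
    rcases P.preFormula_consts_subset hm this.1 with h' | h'
    · exact h'
    · exact (this.2 ⟨h', hcW⟩).elim

theorem SafetyProblem.Arises.isCube (hbad : P.bad.IsMonomial) (harr : P.EliminatesArrays B A)
    {m : Formula X} (hA : P.Arises B A m) : m.IsCube := by
  induction hA with
  | bad => exact ⟨hbad, P.bad_ground.1, P.bad_consts⟩
  | pred m M i hA hM ih => exact harr.isCube_predecessor hA ih hM i

/-- The values of the program variables in a structure. -/
def Struct.state (M : Struct X) : State X := fun _ x => M _ (.cur x)

/-- A bad state is reached from `a` in `d` steps. -/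
def SafetyProblem.ReachesBad (P : SafetyProblem X) : ℕ → State X → Prop
  | 0, a => Models (State.pair a a) P.bad
  | d + 1, a => ∃ b, Models (State.pair a b) P.tr ∧ P.ReachesBad d b

theorem Formula.Ground.models_pair_state {φ : Formula X} (hφ : φ.Ground)
    (hc : φ.consts ⊆ curSet X) {M : Struct X} {e : Env} (h : φ.Sat M e) (b : State X) :
    Models (State.pair (Struct.state M) b) φ := by
  refine hφ.models_of_sat (e := e) ((hφ.sat_congr e e fun s c h => ?_).1 h)
  obtain ⟨_, x, h⟩ := hc h
  cases h
  rfl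

theorem SafetyProblem.ReachesBad.exists_path {d : ℕ} {a : State X} (h : P.ReachesBad d a) :
    ∃ f : ℕ → State X, f 0 = a ∧ (∀ i < d, Models (State.pair (f i) (f (i + 1))) P.tr) ∧
      Models (State.pair (f d) (f d)) P.bad := by
  induction d generalizing a with
  | zero => exact ⟨fun _ => a, rfl, by simp, h⟩
  | succ d ih =>
    obtain ⟨b, hab, hb⟩ := h
    obtain ⟨f, rfl, hf, hfd⟩ := ih hb
    refine ⟨fun n => Nat.casesOn n a f, rfl, fun i hi => ?_, hfd⟩
    cases i with
    | zero => exact hab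
    | succ i => exact hf i (by omega)

theorem SafetyProblem.ReachesBad.hasCounterexample {d : ℕ} {M : Struct X} {e : Env}
    (h : P.ReachesBad d (Struct.state M)) (hM : P.init.Sat M e) : P.HasCounterexample d := by
  obtain ⟨f, hf0, hf⟩ := h.exists_path
  exact ⟨f, hf0 ▸ P.init_ground.models_pair_state P.init_consts hM _, hf⟩

/-- Two changes of structure undo the construction: the first interprets the abstracted constants by
the values of the variables, the second supplies the eliminated ones through the under-approximation
property. Neither touches the pre-state. The post-state of the final structure satisfies `m`, with
Skolem values for its variables. -/
theorem SafetyProblem.EliminatesArrays.reachesBad_predecessor (harr : P.EliminatesArrays B A)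
    {m : Formula X} (hA : P.Arises B A m) (hm : m.IsCube) {M : Struct X}
    (hM : Models M (P.preFormula m)) {d : ℕ}
    (hd : ∀ M e, m.Sat M e → P.ReachesBad d (Struct.state M)) (i : ℕ) {M₁ : Struct X} {e : Env}
    (h₁ : (P.predecessor B A m M i).body.Sat M₁ e) :
    P.ReachesBad (d + 1) (Struct.state M₁) := by
  have hpre := P.preFormula_ground hm.qf
  have hψ : (P.project B m M).1.Ground := (B.ground_monomial _ _ _ hpre hM).2
  obtain ⟨M₂, h₁₂, h₂⟩ := (harr.abstractionSpec hA hm hM).exists_agreeOff h₁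
  obtain ⟨M₃, h₂₃, h₃⟩ := B.under _ _ _ hpre hM M₂ (hψ.models_of_sat h₂)
  have hW : (P.project B m M).2 ⊆ nxtSet X ∪ skSet X := (B.consts_sub _ _ _ hpre hM).1
  have hcur : ∀ s (x : X s), (⟨s, .cur x⟩ : AnyConst X) ∉ nxtSet X ∪ skSet X := by
    rintro s x (⟨_, _, h⟩ | ⟨_, h⟩) <;> cases h
  have hstate : Struct.state M₁ = Struct.state M₃ := by
    funext s x
    exact (h₁₂ s _ fun h => hcur s x (hW h)).trans (h₂₃ s _ fun h => hcur s x h.1)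
  rw [hstate]
  obtain ⟨htr, hm'⟩ := h₃ e
  refine ⟨fun s x => M₃ s (.nxt x), ?_, ?_⟩
  · refine P.tr_ground.models_of_sat (e := e) ((P.tr_ground.sat_congr e e fun s c h => ?_).1 htr)
    rcases P.tr_consts h with ⟨_, _, h⟩ | ⟨_, _, h⟩ <;> cases h <;> rfl
  · exact hd _ _ ((Formula.sat_prime_skolem hm.qf).1 hm')

/-- The proof obligations that can be met at level `N`, `d` predecessor steps away from `Bad`. -/
def SafetyProblem.pobs (P : SafetyProblem X) (B : MBP X) (A : Abstraction X) (N : ℕ) :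
    ℕ → Set (POB X)
  | 0 => {⟨P.bad, Subst.empty, N⟩}
  | d + 1 => {r | ∃ q ∈ P.pobs B A N d, ∃ M, Models M (P.preFormula q.body) ∧
      r = P.predecessor B A q.body M (N - (d + 1))}

theorem SafetyProblem.level_of_mem_pobs {N d : ℕ} {p : POB X} (h : p ∈ P.pobs B A N d) :
    p.level = N - d := by
  cases d with
  | zero => cases h; rfl
  | succ d => obtain ⟨q, -, M, -, rfl⟩ := h; rfl

theorem SafetyProblem.arises_of_mem_pobs {N d : ℕ} {p : POB X} (h : p ∈ P.pobs B A N d) :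
    P.Arises B A p.body := by
  induction d generalizing p with
  | zero => cases h; exact .bad
  | succ d ih => obtain ⟨q, hq, M, hM, rfl⟩ := h; exact .pred _ _ _ (ih hq) hM

/-- The next depth is the image, under abstraction, of a finite union of the finite ranges of
projection. -/
theorem SafetyProblem.finite_pobs (hbad : P.bad.IsMonomial) (harr : P.EliminatesArrays B A)
    (N d : ℕ) : (P.pobs B A N d).Finite := by
  induction d with
  | zero => exact Set.finite_singleton _
  | succ d ih =>
    have : (⋃ q ∈ P.pobs B A N d,
        (fun r : Formula X × Set (AnyConst X) =>
          (⟨(A.abs r.2 r.1).1, (A.abs r.2 r.1).2, N - (d + 1)⟩ : POB X)) ''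
        {r | ∃ M, Models M (P.preFormula q.body) ∧
          r = B.mbp (nxtSet X ∪ skSet X) (P.preFormula q.body) M}).Finite :=
      ih.biUnion fun q hq => (B.finite_range _ _ (P.preFormula_ground
        ((arises_of_mem_pobs hq).isCube hbad harr).qf)).image _
    refine this.subset ?_
    rintro r ⟨q, hq, M, hM, rfl⟩
    exact Set.mem_biUnion hq ⟨_, ⟨M, hM, rfl⟩, rfl⟩

theorem SafetyProblem.reachesBad_of_mem_pobs (hbad : P.bad.IsMonomial)
    (harr : P.EliminatesArrays B A) {N d : ℕ} {p : POB X} (h : p ∈ P.pobs B A N d)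
    {M : Struct X} {e : Env} (hM : p.body.Sat M e) : P.ReachesBad d (Struct.state M) := by
  induction d generalizing p M e with
  | zero => cases h; exact P.bad_ground.models_pair_state P.bad_consts hM _
  | succ d ih =>
    obtain ⟨q, hq, M', hM', rfl⟩ := h
    have hA := arises_of_mem_pobs hq
    exact harr.reachesBad_predecessor hA (hA.isCube hbad harr) hM' (fun M e h => ih hq h) _ hM

/-- The instance of a proof obligation is ground. -/
structure POB.WellFormed (p : POB X) : Prop where
  isCube : p.body.IsCube
  mem_dom : ∀ i ∈ p.body.fvars, i ∈ p.inst.dom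
  isGround : p.inst.IsGround

theorem SafetyProblem.wellFormed_of_mem_pobs (hbad : P.bad.IsMonomial)
    (harr : P.EliminatesArrays B A) {N d : ℕ} {p : POB X} (h : p ∈ P.pobs B A N d) :
    p.WellFormed := by
  have hp := (arises_of_mem_pobs h).isCube hbad harr
  cases d with
  | zero =>
    cases h
    exact ⟨hp, by simp [P.bad_ground.2], fun i t h => by cases h⟩
  | succ d =>
    obtain ⟨q, hq, M, hM, rfl⟩ := h
    have hA := arises_of_mem_pobs hq
    have := harr.abstractionSpec hA (hA.isCube hbad harr) hM
    exact ⟨hp, fun i hi => this.mem_dom hi, this.isGround⟩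

end Predecessor

/-! ## Frames and blocking lemmas -/

/-- The body of a frame lemma is quantifier free and its instance is ground. -/
structure FrameLemma.WellFormed (l : FrameLemma X) : Prop where
  qf : l.body.QF
  mem_dom : ∀ i ∈ l.body.fvars, i ∈ l.inst.dom
  isGround : l.inst.IsGround

theorem FrameLemma.WellFormed.ground {l : FrameLemma X} (h : l.WellFormed) :
    (l.body.subst l.inst).Ground :=
  ⟨(Formula.qf_subst _).2 h.qf, Formula.fvars_subst_eq_empty h.isGround h.qf h.mem_dom⟩

theorem qi_ground {Q : Frame X} (h : ∀ l ∈ Q, l.WellFormed) : (qi Q).Ground := by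
  constructor
  · simp only [qi, Formula.qf_conj, List.forall_mem_map]
    exact fun l hl => (h l hl).ground.1
  · apply Formula.fvars_conj_eq_empty
    simp only [List.forall_mem_map]
    exact fun l hl => (h l hl).ground.2

theorem sat_qi {Q : Frame X} {M : Struct X} {e : Env} :
    (qi Q).Sat M e ↔ ∀ l ∈ Q, (l.body.subst l.inst).Sat M e := by
  simp [qi, Formula.sat_conj]

theorem Trace.subset_add (Q : Trace X) (i : ℕ) (l : FrameLemma X) (j : ℕ) :
    Q j ⊆ Trace.add Q i l j := by
  unfold Trace.add
  split
  · exact List.subset_cons_self _ _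
  · exact List.Subset.refl _

/-- The interpolant mentions only constants of `m'_sk`, so unpriming and abstracting Skolem
constants gives a formula in the variables of `m`. The substitution of the obligation therefore
grounds it. The entailment is stated with free variables, so that it can be instantiated by that
substitution. -/
theorem SafetyProblem.blockingLemma_spec (P : SafetyProblem X) (I : Interpolation X)
    (A : Abstraction X) {Q : Frame X} (hQ : (qi Q).Ground) {m : Formula X} (hm : m.IsCube)
    (h : Entails ((qi Q).and P.tr) m.prime.skolem.not) :
    (P.blockingLemma I A Q m).QF ∧ (P.blockingLemma I A Q m).fvars ⊆ m.fvars ∧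
      Entails (P.blockingLemma I A Q m) m.not := by
  have hA := hQ.and P.tr_ground
  have hB := hm.qf.ground_prime_skolem
  have hBm : m.prime.skolem.IsMonomial :=
    (Formula.isMonomial_subst _).2 ((Formula.isMonomial_mapC _).2 hm.isMonomial)
  set L := (I.itp ((qi Q).and P.tr) m.prime.skolem).1 with hL
  have hLg : L.Ground := (I.ground_clause _ _ hA hB hBm h).2
  have hLc : L.consts ⊆ m.prime.skolem.consts := by
    obtain ⟨h₁, h₂⟩ := I.consts_sub _ _ hA hB hBm h
    exact fun c hc => (h₂ hc).elim And.right fun hc => (h₁ hc).1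
  have hLB : Entails L m.prime.skolem.not := I.right _ _ hA hB hBm h
  have spec : AbstractionSpec (skSet X) L.unprime (A.abs (skSet X) L.unprime) :=
    A.abstractionSpec (hLg.mapC _) fun c ⟨_, _, h⟩ => by rw [h]
  set ℓ := P.blockingLemma I A Q m with hℓ
  set σ := (A.abs (skSet X) L.unprime).2
  have hsubst : ℓ.subst σ = L.unprime := spec.subst_eq
  have hqf : ℓ.QF := spec.qf
  have hσ : ∀ i ∈ ℓ.fvars, σ i = some (.con (.sk i)) ∧
      (⟨Srt.int, .sk i⟩ : AnyConst X) ∈ L.unprime.consts := by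
    intro i hi
    obtain ⟨c, ⟨j, hj⟩, hic⟩ := spec.exists_const i hi
    cases hj
    have hmem : (⟨Srt.int, .sk j⟩ : AnyConst X) ∈ L.unprime.consts := by
      rw [← hsubst, Formula.mem_consts_subst hqf]
      exact .inr ⟨i, hi, _, hic, rfl⟩
    -- Variable `i` stands for `sk j`, but `sk j` is always replaced by variable `j`; hence `i = j`.
    obtain rfl := spec.injective _ _ _ hic (spec.sk j ⟨⟨j, rfl⟩, hmem⟩)
    exact ⟨hic, hmem⟩
  refine ⟨hqf, fun i hi => ?_, fun M e hM hmM => ?_⟩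
  · have := (hσ i hi).2
    rw [Formula.unprime, Formula.consts_mapC] at this
    obtain ⟨⟨s, c⟩, hc, hci⟩ := this
    rcases Formula.consts_prime_skolem_subset hm.qf hm.consts_subset (hLc hc) with
      ⟨_, _, h⟩ | ⟨j, hj, h⟩
    · cases h; cases hci
    · cases h; cases hci; exact hj
  -- Skolem constants take the values of the variables. Reading this structure through
  -- `Const.unprime` identifies post-state with pre-state, and refutes the interpolant and `m'_sk`
  -- together.
  · let M' : Struct X := fun _ c => match c with
      | .cur x => M _ (.cur x)
      | .nxt x => M _ (.nxt x)
      | .sk i => e i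
    have h₁ : L.unprime.Sat M' e := by
      rw [← hsubst, Formula.sat_subst _ _ _ hqf]
      refine (ℓ.sat_congr (fun s c hc => ?_) fun i hi => ?_).1 hM
      · cases c with
        | cur x => rfl
        | nxt x => rfl
        | sk i => exact ((spec.consts_subset hc).2 ⟨i, rfl⟩).elim
      · simp [Subst.env, (hσ i hi).1, Term.eval, M']
    rw [Formula.unprime, Formula.sat_mapC] at h₁
    refine hLB _ _ h₁ ((Formula.sat_prime_skolem hm.qf).2 ?_)
    refine (m.sat_congr (fun s c hc => ?_) fun i hi => rfl).1 hmM
    obtain ⟨_, x, h⟩ := hm.consts_subset hc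
    cases h
    rfl

/-- The instance of the proof obligation is excluded by its frame. -/
def POB.Blocked (p : POB X) (Q : Trace X) : Prop :=
  Entails (qi (Q p.level)) (p.body.subst p.inst).not

theorem POB.Blocked.mono {p : POB X} {Q Q' : Trace X} (hQ : ∀ j, Q j ⊆ Q' j)
    (h : p.Blocked Q) : p.Blocked Q' :=
  fun M e hM => h M e (sat_qi.2 fun l hl => sat_qi.1 hM l (hQ _ hl))

theorem POB.blocked_add {p : POB X} {Q : Trace X} {l : FrameLemma X}
    (h : Entails (l.body.subst l.inst) (p.body.subst p.inst).not) :
    p.Blocked (Trace.add Q p.level l) :=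
  fun M e hM => h M e (sat_qi.1 hM l (by simp [Trace.add]))

theorem QGenCandidate.wellFormed {ℓ : Formula X} {ξ : Subst X} {c : FrameLemma X}
    (h : QGenCandidate ℓ ξ c) : c.WellFormed :=
  ⟨h.1, h.2.2.1, h.2.2.2.1⟩

/-! ## The invariant -/

section Run

variable {P : SafetyProblem X} {S : Solver X} {B : MBP X} {I : Interpolation X}
  {A : Abstraction X}

/-- All proof obligations that can be met at level `N`. -/
def SafetyProblem.allPobs (P : SafetyProblem X) (B : MBP X) (A : Abstraction X) (N : ℕ) :
    Set (POB X) :=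
  {p | ∃ d ≤ N, p ∈ P.pobs B A N d}

theorem SafetyProblem.finite_allPobs (hbad : P.bad.IsMonomial) (harr : P.EliminatesArrays B A)
    (N : ℕ) : (P.allPobs B A N).Finite := by
  have : P.allPobs B A N = ⋃ d ∈ Set.Iic N, P.pobs B A N d := by
    ext; simp [SafetyProblem.allPobs]
  rw [this]
  exact (Set.finite_Iic N).biUnion fun d _ => P.finite_pobs hbad harr N d

theorem SafetyProblem.wellFormed_of_mem_allPobs (hbad : P.bad.IsMonomial)
    (harr : P.EliminatesArrays B A) {N : ℕ} {p : POB X} (h : p ∈ P.allPobs B A N) :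
    p.WellFormed :=
  let ⟨_, _, h⟩ := h
  P.wellFormed_of_mem_pobs hbad harr h

/-- All proof obligations in the queue arise from `Bad`, and those of level `0` intersect the
initial states. -/
def QueueInv (P : SafetyProblem X) (B : MBP X) (A : Abstraction X) (N : ℕ)
    (queue : Set (POB X)) : Prop :=
  ∀ p ∈ queue, p ∈ P.allPobs B A N ∧ (p.level = 0 → ∃ M e, P.init.Sat M e ∧ p.body.Sat M e)

/-- The control part of the invariant of `Quic3_Main`. -/
def ControlInv (P : SafetyProblem X) (B : MBP X) (A : Abstraction X) (N : ℕ) :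
    Control X → Prop
  | .start => N = 0
  | .loop => True
  | .makeSafe queue => QueueInv P B A N queue
  | .qgen queue p ℓ cands =>
      QueueInv P B A N queue ∧ p ∈ P.allPobs B A N ∧ (⟨ℓ, p.inst⟩ : FrameLemma X).WellFormed ∧
      Entails (ℓ.subst p.inst) (p.body.subst p.inst).not ∧ ∀ c ∈ cands, QGenCandidate ℓ p.inst c
  | .push _ => True
  | .pushing i _ _ => i < N
  | .ret .safe => True
  | .ret .cex => P.HasCounterexample N
  | .hang => False

/-- The trace part of the invariant of `Quic3_Main`. -/
structure TraceInv (P : SafetyProblem X) (Q : Trace X) : Prop where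
  wellFormed : ∀ i, ∀ l ∈ Q i, l.WellFormed
  init_mem : ⟨P.init, Subst.empty⟩ ∈ Q 0

/-- The invariant of `Quic3_Main`. -/
structure Config.Inv (P : SafetyProblem X) (B : MBP X) (A : Abstraction X) (c : Config X) :
    Prop where
  trace : TraceInv P c.trace
  ctrl : ControlInv P B A c.N c.ctrl

theorem SafetyProblem.initial_inv (P : SafetyProblem X) (B : MBP X) (A : Abstraction X) : P.initial.Inv P B A := by
  refine ⟨⟨fun i l hl => ?_, by simp [SafetyProblem.initial]⟩, rfl⟩
  simp only [SafetyProblem.initial] at hl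
  split at hl
  · simp only [List.mem_singleton] at hl
    subst hl
    exact ⟨P.init_ground.1, by simp [P.init_ground.2], fun i t h => by cases h⟩
  · simp at hl

theorem TraceInv.add {Q : Trace X} (h : TraceInv P Q) (i : ℕ) {l : FrameLemma X}
    (hl : l.WellFormed) : TraceInv P (Trace.add Q i l) := by
  refine ⟨fun j l' hl' => ?_, Trace.subset_add _ _ _ _ h.init_mem⟩
  unfold Trace.add at hl'
  split at hl'
  · rcases List.mem_cons.1 hl' with rfl | hl'
    · exact hl
    · exact h.wellFormed _ _ hl'
  · exact h.wellFormed _ _ hl'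

/-- The cleared frame has positive index, so `Init` stays in `Q 0`. -/
theorem TraceInv.update {Q : Trace X} (h : TraceInv P Q) (n : ℕ) :
    TraceInv P (Function.update Q (n + 1) []) := by
  refine ⟨fun j l hl => ?_, by simpa [Function.update] using h.init_mem⟩
  by_cases hj : j = n + 1
  · subst hj; simp at hl
  · exact h.wellFormed j l (by simpa [hj] using hl)

theorem TraceInv.qi_ground {Q : Trace X} (h : TraceInv P Q) (i : ℕ) : (qi (Q i)).Ground :=
  Quic3.qi_ground (h.wellFormed i)

theorem Pushable.wellFormed {Q Q' : Frame X} {c : FrameLemma X} (h : Pushable Q Q' c)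
    (hQ : ∀ l ∈ Q, l.WellFormed) : c.WellFormed := by
  obtain ⟨⟨l, hl, hinst, hd⟩, -⟩ := h
  have hl := hQ l hl
  exact ⟨hd.qf hl.qf, fun i hi => hinst ▸ hl.mem_dom i (hd.fvars hi), hinst ▸ hl.isGround⟩

/-- The chosen instantiations need not be ground, so the query may have free variables; quantifier
freeness is all that the solver requires. -/
theorem SafetyProblem.qf_pushQuery (P : SafetyProblem X) {Q : Frame X}
    (hQ : ∀ l ∈ Q, l.WellFormed) (ρs : List (Subst X)) {φ : Formula X} (hφ : φ.QF) :
    (P.pushQuery Q ρs φ).QF := by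
  simp only [SafetyProblem.pushQuery, Formula.qf_conj, List.forall_mem_cons, List.forall_mem_map,
    Formula.qf_subst]
  exact ⟨fun _ _ => hφ, fun l hl _ _ => (hQ l hl).qf, (qi_ground hQ).1, P.tr_ground.1,
    Formula.qf_prime.2 hφ, by simp⟩

theorem SafetyProblem.qf_qgenQuery (P : SafetyProblem X) {Q : Frame X} (hQ : (qi Q).Ground)
    {φ : Formula X} (hφ : φ.QF) : ((P.fwd (qi Q)).and φ.prime.not).QF :=
  ⟨⟨⟨hQ.1, P.tr_ground.1⟩, Formula.qf_prime.2 P.init_ground.1⟩, Formula.qf_prime.2 hφ⟩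

theorem QueueInv.mono {N : ℕ} {q q' : Set (POB X)} (h : QueueInv P B A N q) (hq : q' ⊆ q) :
    QueueInv P B A N q' :=
  fun p hp => h p (hq hp)

theorem Solver.not_diverges (S : Solver X) {φ : Formula X} (h : S.call φ .diverges)
    (hφ : φ.QF) : False :=
  S.terminates φ hφ h

/-- A model of the query of a proof obligation. -/
theorem models_preFormula_of_call {Q : Frame X} {m : Formula X} (hm : m.QF) {M : Struct X}
    (h : S.call ((qi Q).and (P.preFormula m)) (.sat M)) : Models M (P.preFormula m) :=
  let ⟨_, he⟩ := S.sat_sound _ _ h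
  (P.preFormula_ground hm).models_of_sat he.2

/-- A positive level means that the depth is still below `N`, so the truncated subtraction `N - (d +
1)` is a true one. -/
theorem predecessor_mem_allPobs {N : ℕ} {p : POB X} (hp : p ∈ P.allPobs B A N) {i : ℕ}
    (hi : p.level = i + 1) {M : Struct X} (hM : Models M (P.preFormula p.body)) :
    P.predecessor B A p.body M i ∈ P.allPobs B A N := by
  obtain ⟨d, hd, hp⟩ := hp
  have := P.level_of_mem_pobs hp
  obtain rfl : i = N - (d + 1) := by omega
  exact ⟨d + 1, by omega, p, hp, M, hM, rfl⟩

/-- The model that yields a predecessor satisfies its instance. -/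
theorem sat_predecessor (hbad : P.bad.IsMonomial) (harr : P.EliminatesArrays B A) {N : ℕ}
    {p : POB X} (hp : p ∈ P.allPobs B A N) {M : Struct X}
    (hM : Models M (P.preFormula p.body)) (i : ℕ) :
    Models M ((P.predecessor B A p.body M i).body.subst (P.predecessor B A p.body M i).inst) := by
  obtain ⟨d, -, hp⟩ := hp
  have hA := P.arises_of_mem_pobs hp
  have hm := hA.isCube hbad harr
  have h : Models M (P.project B p.body M).1 := B.models _ _ _ (P.preFormula_ground hm.qf) hM
  have h' := (harr.abstractionSpec hA hm hM).subst_eq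
  change Models M (Formula.subst (A.abs _ _).2 (A.abs _ _).1)
  rw [h']
  exact h

/-- The solver's model satisfies both the frame and the instance of the new obligation. This is
where it matters that projection preserves the given model. -/
theorem not_blocked_predecessor (hbad : P.bad.IsMonomial) (harr : P.EliminatesArrays B A)
    {N : ℕ} {p : POB X} (hp : p ∈ P.allPobs B A N) {i : ℕ} {M : Struct X} {Q : Trace X}
    (h : S.call ((qi (Q i)).and (P.preFormula p.body)) (.sat M)) :
    ¬ (P.predecessor B A p.body M i).Blocked Q := by
  have hM := models_preFormula_of_call (P.wellFormed_of_mem_allPobs hbad harr hp).isCube.qf h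
  obtain ⟨e, he⟩ := S.sat_sound _ _ h
  exact fun hb => hb M e he.1 (sat_predecessor hbad harr hp hM i e)

/-- A predecessor of level `0` comes from a query over `Q 0`, which contains `Init`; the model of
that query is the required common model. -/
theorem QueueInv.predecessor (hbad : P.bad.IsMonomial) (harr : P.EliminatesArrays B A) {N : ℕ}
    {Q : Trace X} (hQ : TraceInv P Q) {queue : Set (POB X)} (hq : QueueInv P B A N queue)
    {p : POB X} (hp : p ∈ queue) {i : ℕ} (hi : p.level = i + 1) {M : Struct X}
    (h : S.call ((qi (Q i)).and (P.preFormula p.body)) (.sat M)) :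
    QueueInv P B A N (insert (P.predecessor B A p.body M i) queue) := by
  have hp := (hq p hp).1
  have hM := models_preFormula_of_call (P.wellFormed_of_mem_allPobs hbad harr hp).isCube.qf h
  have hr := predecessor_mem_allPobs hp hi hM
  rintro r (rfl | hrq)
  · refine ⟨hr, fun h0 => ?_⟩
    obtain rfl : i = 0 := h0
    obtain ⟨e, he⟩ := S.sat_sound _ _ h
    have h₁ := sat_qi.1 he.1 _ hQ.init_mem
    rw [Formula.subst_empty] at h₁
    have hs := sat_predecessor hbad harr hp hM 0 e
    rw [Formula.sat_subst _ _ _ (P.wellFormed_of_mem_allPobs hbad harr hr).isCube.qf] at hs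
    exact ⟨M, _, P.init_ground.models_of_sat h₁ _, hs⟩
  · exact hq r hrq

/-- Since the level is `N - d` with `d ≤ N`, level `0` means depth exactly `N`, which gives a path
of that length. -/
theorem QueueInv.hasCounterexample (hbad : P.bad.IsMonomial) (harr : P.EliminatesArrays B A)
    {N : ℕ} {queue : Set (POB X)} (hq : QueueInv P B A N queue) {p : POB X} (hp : p ∈ queue)
    (h0 : p.level = 0) : P.HasCounterexample N := by
  obtain ⟨⟨d, hd, hpd⟩, h⟩ := hq p hp
  obtain ⟨M, e, hi, hb⟩ := h h0
  have := P.level_of_mem_pobs hpd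
  obtain rfl : d = N := by omega
  exact (P.reachesBad_of_mem_pobs hbad harr hpd hb).hasCounterexample hi

/-- The diverging cases are vacuous because their queries are quantifier free. The substantial case
is `block`, where the unsatisfiable query is what licenses interpolation. -/
theorem Step.inv (hbad : P.bad.IsMonomial) (harr : P.EliminatesArrays B A) {c c' : Config X}
    (hc : c.Inv P B A) (h : Step P S B I A c c') : c'.Inv P B A := by
  obtain ⟨hQ, hctrl⟩ := hc
  cases h with
  | start_sat N Q M h =>
    obtain rfl : N = 0 := hctrl
    obtain ⟨e, hi, hb⟩ := S.sat_sound _ _ h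
    have : P.ReachesBad 0 (Struct.state M) :=
      P.bad_ground.models_pair_state P.bad_consts hb _
    exact ⟨hQ, this.hasCounterexample hi⟩
  | start_unsat N Q h => exact ⟨hQ, trivial⟩
  | start_hang N Q h => exact (S.not_diverges h ⟨P.init_ground.1, P.bad_ground.1⟩).elim
  | unfold N Q =>
    refine ⟨hQ.update N, ?_⟩
    rintro p rfl
    exact ⟨⟨0, Nat.zero_le _, rfl⟩, fun h => by cases h⟩
  | blocked N Q => exact ⟨hQ, trivial⟩
  | cex N Q queue p hp h0 => exact ⟨hQ, hctrl.hasCounterexample hbad harr hp.1 h0⟩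
  | predecessor N Q queue p i M hp hi h =>
    exact ⟨hQ, QueueInv.predecessor hbad harr hQ hctrl hp.1 hi h⟩
  | block N Q queue p i cands hp hi h hcands =>
    have hpa := (hctrl p hp.1).1
    have hw := P.wellFormed_of_mem_allPobs hbad harr hpa
    obtain ⟨h₁, h₂, h₃⟩ := P.blockingLemma_spec I A (hQ.qi_ground i) hw.isCube
      fun M e h₁ h₂ => S.unsat_sound _ h ⟨M, e, h₁.1, h₁.2, h₂⟩
    refine ⟨hQ, hctrl.mono Set.sdiff_subset, hpa,
      ⟨h₁, fun i hi => hw.mem_dom i (h₂ hi), hw.isGround⟩, fun M e h₄ h₅ => ?_, hcands⟩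
    -- The lemma and the obligation share one substitution, hence one induced assignment, to which
    -- the free-variable entailment applies.
    rw [Formula.sat_subst _ _ _ h₁] at h₄
    rw [Formula.sat_subst _ _ _ hw.isCube.qf] at h₅
    exact h₃ _ _ h₄ h₅
  | block_hang N Q queue p i hp hi h =>
    have hw := P.wellFormed_of_mem_allPobs hbad harr (hctrl p hp.1).1
    exact (S.not_diverges h ⟨(hQ.qi_ground i).1, (P.preFormula_ground hw.isCube.qf).1⟩).elim
  | qgen_none N Q queue p ℓ => exact ⟨hQ.add _ hctrl.2.2.1, hctrl.1⟩
  | qgen_ok N Q queue p ℓ c cs h =>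
    exact ⟨hQ.add _ (hctrl.2.2.2.2 c (by simp)).wellFormed, hctrl.1⟩
  | qgen_fail N Q queue p ℓ c cs M h =>
    obtain ⟨h₁, h₂, h₃, h₄, h₅⟩ := hctrl
    exact ⟨hQ, h₁, h₂, h₃, h₄, fun c hc => h₅ c (List.mem_cons_of_mem _ hc)⟩
  | qgen_hang N Q queue p ℓ c cs h =>
    exact (S.terminates _ (P.qf_qgenQuery (hQ.qi_ground _)
      (hctrl.2.2.2.2 c (by simp)).wellFormed.qf) h).elim
  | push_frame N Q i ρs cands h => exact ⟨hQ, h⟩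
  | push_safe N Q i hi h => exact ⟨hQ, trivial⟩
  | push_done N Q i hi h => exact ⟨hQ, trivial⟩
  | pushing_nil N Q i ρs => exact ⟨hQ, trivial⟩
  | pushing_skip N Q i ρs c cs h => exact ⟨hQ, hctrl⟩
  | pushing_init_fail N Q i ρs c cs M hp h => exact ⟨hQ, hctrl⟩
  | pushing_init_hang N Q i ρs c cs hp h =>
    exact (S.not_diverges h ⟨P.init_ground.1, (hp.wellFormed (hQ.wellFormed i)).qf⟩).elim
  | pushing_fail N Q i ρs c cs M hp h₁ h₂ => exact ⟨hQ, hctrl⟩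
  | pushing_hang N Q i ρs c cs hp h₁ h =>
    exact (S.terminates _ (P.qf_pushQuery (hQ.wellFormed i) ρs
      (hp.wellFormed (hQ.wellFormed i)).qf) h).elim
  | pushing_ok N Q i ρs c cs hp h₁ h₂ =>
    exact ⟨hQ.add _ (hp.wellFormed (hQ.wellFormed i)), hctrl⟩
  | hang N Q => exact hctrl.elim

/-! ## Termination at a fixed level -/

/-- The proof obligations outside `T` that may still have to be blocked. -/
def SafetyProblem.pending (P : SafetyProblem X) (B : MBP X) (A : Abstraction X) (N : ℕ)
    (Q : Trace X) (T : Set (POB X)) : Set (POB X) :=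
  {p | p ∈ P.allPobs B A N ∧ p ∉ T ∧ ¬ p.Blocked Q}

/-- The rank of a configuration, which decreases as long as the level is not raised. -/
noncomputable def Config.rank (P : SafetyProblem X) (B : MBP X) (A : Abstraction X) (c : Config X) :
    ℕ ×ₗ ℕ ×ₗ ℕ :=
  match c.ctrl with
  | .start => toLex (4, toLex (0, 0))
  | .makeSafe queue =>
      toLex (3, toLex (2 * (P.pending B A c.N c.trace queue).ncard + queue.ncard, 0))
  | .qgen queue p _ cands =>
      toLex (3, toLex (2 * (P.pending B A c.N c.trace (insert p queue)).ncard + queue.ncard,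
        cands.length + 1))
  | .push i => toLex (2, toLex (2 * (c.N - i) + 1, 0))
  | .pushing i _ cands => toLex (2, toLex (2 * (c.N - i), cands.length))
  | .loop => toLex (1, toLex (0, 0))
  | _ => toLex (0, toLex (0, 0))

theorem toLex_lt_iff {a b c a' b' c' : ℕ} :
    (toLex (a, toLex (b, c)) : ℕ ×ₗ ℕ ×ₗ ℕ) < toLex (a', toLex (b', c')) ↔
      a < a' ∨ a = a' ∧ (b < b' ∨ b = b' ∧ c < c') := by
  simp [Prod.Lex.toLex_lt_toLex]

theorem SafetyProblem.finite_pending (hbad : P.bad.IsMonomial) (harr : P.EliminatesArrays B A)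
    (N : ℕ) (Q : Trace X) (T : Set (POB X)) : (P.pending B A N Q T).Finite :=
  (P.finite_allPobs hbad harr N).subset fun _ h => h.1

/-- Dropping `p` from the excluded set could make only `p` pending, and the new lemma blocks `p`;
all other blocked obligations stay blocked because frames grow. -/
theorem ncard_pending_add_le (hbad : P.bad.IsMonomial) (harr : P.EliminatesArrays B A)
    {N : ℕ} {Q : Trace X} {queue : Set (POB X)} {p : POB X} {l : FrameLemma X}
    (h : Entails (l.body.subst l.inst) (p.body.subst p.inst).not) :
    (P.pending B A N (Trace.add Q p.level l) queue).ncard ≤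
      (P.pending B A N Q (insert p queue)).ncard := by
  refine Set.ncard_le_ncard (fun r hr => ⟨hr.1, ?_, fun hb => hr.2.2 ?_⟩)
    (P.finite_pending hbad harr _ _ _)
  · rintro (rfl | h')
    · exact hr.2.2 (POB.blocked_add h)
    · exact hr.2.1 h'
  · exact hb.mono (Trace.subset_add _ _ _)

/-- The phases descend from `start` through blocking and pushing to `loop`, whose only step raises
the level. Within blocking, a predecessor trades at least one pending obligation for one queued
obligation, and removal shortens the queue. -/
theorem Step.returns_or_raises_or_rank_lt (hbad : P.bad.IsMonomial)
    (harr : P.EliminatesArrays B A) {c c' : Config X} (hc : c.Inv P B A)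
    (h : Step P S B I A c c') :
    (∃ r, c'.ctrl = .ret r) ∨ c'.N = c.N + 1 ∨ c'.N = c.N ∧ c'.rank P B A < c.rank P B A := by
  obtain ⟨hQ, hctrl⟩ := hc
  have hfin : ∀ {N : ℕ} {queue : Set (POB X)}, QueueInv P B A N queue → queue.Finite :=
    fun h => (P.finite_allPobs hbad harr _).subset fun p hp => (h p hp).1
  cases h with
  | start_sat | cex | push_safe => exact .inl ⟨_, rfl⟩
  | unfold => exact .inr (.inl rfl)
  | hang => exact hctrl.elim
  | start_hang N Q h => exact (S.not_diverges h ⟨P.init_ground.1, P.bad_ground.1⟩).elim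
  | block_hang N Q queue p i hp hi h =>
    -- Hanging has the least rank, so entering it counts as a decrease; the invariant excludes it
    -- separately.
    exact .inr (.inr ⟨rfl, toLex_lt_iff.2 (.inl (by simp))⟩)
  | predecessor N Q queue p i M hp hi h =>
    refine .inr (.inr ⟨rfl, toLex_lt_iff.2 (.inr ⟨rfl, .inl ?_⟩)⟩)
    have hpa := (hctrl p hp.1).1
    set r := P.predecessor B A p.body M i
    -- The lowest-level-first order is used here: `r` lies strictly below the minimum of the queue.
    have hrq : r ∉ queue := fun h => by
      have h₁ : p.level ≤ r.level := hp.2 r h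
      have h₂ : r.level = i := rfl
      omega
    have hra : r ∈ P.allPobs B A N := predecessor_mem_allPobs hpa hi
      (models_preFormula_of_call (P.wellFormed_of_mem_allPobs hbad harr hpa).isCube.qf h)
    have hrp : r ∈ P.pending B A N Q queue :=
      ⟨hra, hrq, not_blocked_predecessor hbad harr hpa h⟩
    have hlt : (P.pending B A N Q (insert r queue)).ncard < (P.pending B A N Q queue).ncard := by
      refine Set.ncard_lt_ncard ⟨fun q hq => ⟨hq.1, fun h => hq.2.1 (.inr h), hq.2.2⟩, fun h => ?_⟩
        (P.finite_pending hbad harr _ _ _)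
      exact (h hrp).2.1 (.inl rfl)
    -- The queue grows by one while the pending set loses at least one element; the weight `2` makes
    -- the total drop.
    have hins := Set.ncard_insert_of_notMem hrq (hfin hctrl)
    simp only
    omega
  | block N Q queue p i cands hp hi h hcands =>
    refine .inr (.inr ⟨rfl, toLex_lt_iff.2 (.inr ⟨rfl, .inl ?_⟩)⟩)
    have := Set.ncard_sdiff_singleton_lt_of_mem hp.1 (hfin hctrl)
    -- While its lemma is being generalized, `p` still counts as excluded, so the pending set is
    -- unchanged and the shorter queue gives the decrease.
    rw [Set.insert_sdiff_self_of_mem hp.1]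
    simp only
    omega
  | qgen_none N Q queue p ℓ =>
    refine .inr (.inr ⟨rfl, toLex_lt_iff.2 (.inr ⟨rfl, ?_⟩)⟩)
    have := ncard_pending_add_le hbad harr (N := N) (Q := Q) (queue := queue) (p := p)
      (l := ⟨ℓ, p.inst⟩) hctrl.2.2.2.1
    simp only [List.length_nil]
    omega
  | qgen_ok N Q queue p ℓ c cs h =>
    refine .inr (.inr ⟨rfl, toLex_lt_iff.2 (.inr ⟨rfl, ?_⟩)⟩)
    have hcand := hctrl.2.2.2.2 c (by simp)
    -- A generalization has an instance equivalent to that of the original lemma, so it blocks the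
    -- same obligation.
    have := ncard_pending_add_le hbad harr (N := N) (Q := Q) (queue := queue) (p := p)
      (l := c) fun M e hM => hctrl.2.2.2.1 M e ((hcand.2.2.2.2.1 M e).1 hM)
    simp only [List.length_cons]
    omega
  | pushing_nil N Q i ρs =>
    have hi : i < N := hctrl
    -- With `i < N`, the value `2 * (N - i)` falls by one to `2 * (N - (i + 1)) + 1`.
    exact .inr (.inr ⟨rfl, toLex_lt_iff.2 (.inr ⟨rfl, .inl (by simp only; omega)⟩)⟩)
  | _ => exact .inr (.inr ⟨rfl, toLex_lt_iff.2 (by simp)⟩)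

/-! ### Absence of deadlock, and induction over the levels -/

theorem Config.Inv.exists_step {c : Config X} (hc : c.Inv P B A) (h : ∀ r, c.ctrl ≠ .ret r) :
    ∃ c', Step P S B I A c c' := by
  obtain ⟨N, Q, ctrl⟩ := c
  cases ctrl with
  | start =>
    obtain ⟨o, ho⟩ := S.exists_outcome (P.init.and P.bad)
    cases o with
    | sat M => exact ⟨_, .start_sat _ _ M ho⟩
    | unsat => exact ⟨_, .start_unsat _ _ ho⟩
    | diverges => exact ⟨_, .start_hang _ _ ho⟩
  | loop => exact ⟨_, .unfold _ _⟩
  | makeSafe queue =>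
    rcases queue.eq_empty_or_nonempty with rfl | hne
    · exact ⟨_, .blocked _ _⟩
    obtain ⟨p, hp⟩ : ∃ p, IsTop queue p := by
      -- Well-foundedness of the levels provides a lowest obligation in any nonempty queue.
      obtain ⟨p, hp, hmin⟩ := (measure (POB.level (X := X))).wf.has_min queue hne
      exact ⟨p, hp, fun q hq => not_lt.1 (hmin q hq)⟩
    cases hl : p.level with
    | zero => exact ⟨_, .cex _ _ _ p hp hl⟩
    | succ i =>
      obtain ⟨o, ho⟩ := S.exists_outcome ((qi (Q i)).and (P.preFormula p.body))
      cases o with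
      | sat M => exact ⟨_, .predecessor _ _ _ p i M hp hl ho⟩
      -- Only the existence of some step is at stake, so trying no generalization suffices.
      | unsat => exact ⟨_, .block _ _ _ p i [] hp hl ho (by simp)⟩
      | diverges => exact ⟨_, .block_hang _ _ _ p i hp hl ho⟩
  | qgen queue p ℓ cands =>
    cases cands with
    | nil => exact ⟨_, .qgen_none _ _ _ _ _⟩
    | cons c cs =>
      obtain ⟨o, ho⟩ := S.exists_outcome ((P.fwd (qi (Q (p.level - 1)))).and c.body.prime.not)
      cases o with
      | sat M => exact ⟨_, .qgen_fail _ _ _ _ _ _ _ M ho⟩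
      | unsat => exact ⟨_, .qgen_ok _ _ _ _ _ _ _ ho⟩
      | diverges => exact ⟨_, .qgen_hang _ _ _ _ _ _ _ ho⟩
  | push i =>
    rcases lt_or_ge i N with hi | hi
    · exact ⟨_, .push_frame _ _ _ [] [] hi⟩
    · by_cases hs : SafeCond N Q
      · exact ⟨_, .push_safe _ _ _ hi hs⟩
      · exact ⟨_, .push_done _ _ _ hi hs⟩
  | pushing i ρs cands =>
    cases cands with
    | nil => exact ⟨_, .pushing_nil _ _ _ _⟩
    | cons c cs =>
      by_cases hp : Pushable (Q i) (Q (i + 1)) c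
      · obtain ⟨o, ho⟩ := S.exists_outcome (P.init.and c.body.not)
        cases o with
        | sat M => exact ⟨_, .pushing_init_fail _ _ _ _ _ _ M hp ho⟩
        | diverges => exact ⟨_, .pushing_init_hang _ _ _ _ _ _ hp ho⟩
        | unsat =>
          obtain ⟨o, ho'⟩ := S.exists_outcome (P.pushQuery (Q i) ρs c.body)
          cases o with
          | sat M => exact ⟨_, .pushing_fail _ _ _ _ _ _ M hp ho ho'⟩
          | unsat => exact ⟨_, .pushing_ok _ _ _ _ _ _ hp ho ho'⟩
          | diverges => exact ⟨_, .pushing_hang _ _ _ _ _ _ hp ho ho'⟩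
      · exact ⟨_, .pushing_skip _ _ _ _ _ _ hp⟩
  | ret r => exact (h r rfl).elim
  | hang => exact hc.ctrl.elim

/-- Well-founded induction on the rank; the repeating branch of a maximal run cannot occur before a
return. -/
theorem IsRun.exists_returns_or_raises (hbad : P.bad.IsMonomial)
    (harr : P.EliminatesArrays B A) {run : ℕ → Config X} (hrun : IsRun P S B I A run) {n : ℕ}
    (hn : (run n).Inv P B A) :
    ∃ m, (run m).Inv P B A ∧ ((∃ r, (run m).ctrl = .ret r) ∨ (run m).N = (run n).N + 1) := by
  induction hrk : (run n).rank P B A using WellFoundedLT.induction generalizing n with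
  | ind rk ih =>
    by_cases hret : ∃ r, (run n).ctrl = .ret r
    · exact ⟨n, hn, .inl hret⟩
    rcases hrun.2 n with hstep | ⟨hstuck, -⟩
    · have hinv := hstep.inv hbad harr hn
      rcases hstep.returns_or_raises_or_rank_lt hbad harr hn with h | h | ⟨hN, hlt⟩
      · exact ⟨n + 1, hinv, .inl h⟩
      · exact ⟨n + 1, hinv, .inr h⟩
      · obtain ⟨m, hm, h⟩ := ih _ (hrk ▸ hlt) hinv rfl
        exact ⟨m, hm, hN ▸ h⟩
    · exact (hstuck (hn.exists_step fun r h => hret ⟨r, h⟩)).elim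

/-- Each raise is by exactly one, so no level is skipped. The invariant is kept in the conclusion
because it carries the counterexample when the result is `cex`. -/
theorem IsRun.exists_returns_or_level_eq (hbad : P.bad.IsMonomial)
    (harr : P.EliminatesArrays B A) {run : ℕ → Config X} (hrun : IsRun P S B I A run) (k : ℕ) :
    ∃ n, (run n).Inv P B A ∧ ((∃ r, (run n).ctrl = .ret r) ∨ (run n).N = k) := by
  induction k with
  | zero =>
    refine ⟨0, ?_, .inr ?_⟩ <;> rw [hrun.1]
    · exact P.initial_inv B A
    · rfl
  | succ k ih =>
    obtain ⟨n, hn, h | rfl⟩ := ih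
    · exact ⟨n, hn, .inl h⟩
    · exact hrun.exists_returns_or_raises hbad harr hn

end Run

end Quic3

theorem mainTheorem2 {X : Quic3.Srt → Type*} (P : Quic3.SafetyProblem X)
    (hbad : P.bad.IsMonomial)
    (S : Quic3.Solver X) (B : Quic3.MBP X) (I : Quic3.Interpolation X) (A : Quic3.Abstraction X)
    (harr : P.EliminatesArrays B A)
    (run : ℕ → Quic3.Config X) (hrun : Quic3.IsRun P S B I A run) (k : ℕ) :
    ∃ n, (run n).N = k ∨
      (run n).ctrl = Quic3.Control.ret Quic3.Result.safe ∨
      ((run n).ctrl = Quic3.Control.ret Quic3.Result.cex ∧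
        P.HasCounterexample (run n).N) := by
  obtain ⟨n, hn, ⟨r, hr⟩ | hN⟩ := hrun.exists_returns_or_level_eq hbad harr k
  · have hc := hn.ctrl
    rw [hr] at hc
    cases r with
    | safe => exact ⟨n, .inr (.inl hr)⟩
    | cex => exact ⟨n, .inr (.inr ⟨hr, hc⟩)⟩
  · exact ⟨n, .inl hN⟩
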